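/- **Setting.** Let $d\in\{1,2\}$. For $d=1$ let $\Omega=(\alpha,\beta)$ be an interval with a subdivision $\mathcal T$ given by $\alpha=a_0<a_1<\dots<a_n=\beta$, with $h_k=a_k-a_{k-1}$. For $d=2$ let $\Omega\subset\mathbb R^2$ be open and let $\mathcal T$ be a finite conforming triangulation of $\overline\Omega$ into nondegenerate closed triangles (two triangles meet in a common, possibly empty, face) such that $\partial\Omega$ is a union of edges of triangles. For a triangle $T$ let $|T|$ be its area and $\theta_{T,1},\theta_{T,2},\theta_{T,3}$ its interior angles; assume that there are $0<t_{\min}\le t_{\max}<\pi/2$ with $t_{\min}\le\theta_{T,k}\le t_{\max}$ for all $T\in\mathcal T$ and $k=1,2,3$. Let $a_1,\dots,a_N$ (renumbered) denote the vertices of $\mathcal T$ that lie in $\Omega$, let $\varphi_1,\dots,\varphi_N$ be the nodal basis functions (continuous, affine on each element, $\varphi_i(a_j)=\delta_{ij}$, and zero at all vertices on $\partial\Omega$), and let $\mathcal V=\operatorname{span}\{\varphi_1,\dots,\varphi_N\}$. Let $b:\Omega\times\mathbb R\to\mathbb R$ be such that $b(\cdot,\eta)$ is measurable for every $\eta\in\mathbb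 R$ and, for a.e. $x\in\Omega$, $b(x,\cdot)$ is $C^1$ with $0\le\frac{\partial b}{\partial\eta}(x,\eta)\le B_\eta$ for all $\eta\in\mathbb R$, with a constant $B_\eta\ge 0$. Let $u_1\in\mathcal V$ be a subsolution and $u_2\in\mathcal V$ a supersolution of the discrete semilinear problem; that is, for every $v\in\mathcal V$ with $v\ge0$ the integrands below are integrable and $$\int_\Omega \nabla u_1\cdot\nabla v+b(x,u_1)\,v\,dx\le 0,\qquad \int_\Omega \nabla u_2\cdot\nabla v+b(x,u_2)\,v\,dx\ge 0 .$$ With $z(t)=t\,u_1+(1-t)\,u_2$ let $A=S+M\in\mathbb R^{N\times N}$ be the matrix with $$s_{ij}=\sum_{T\in\mathcal T}\int_T\nabla\varphi_i\cdot\nabla\varphi_j\,dx,\qquad m_{ij}=\sum_{T\in\mathcal T}\int_T\int_0^1\frac{\partial b}{\partial\eta}(x,z(t))\,\varphi_i\varphi_j\,dt\,dx .$$ **Theorem.** Assume that $$B_\eta\,h_k^2\le 6\quad\text{for } k=1,\dots,n,\ \text{ if } d=1,\qquad\qquad B_\eta\,|T|\le 6\min_{k=1,2,3}\cot\theta_{T,k}\quad\text{for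 each } T\in\mathcal T,\ \text{ if } d=2 .$$ (For $B_\eta>0$ these read $h_k^2\le 6/B_\eta$ and $|T|\le \frac{6}{B_\eta}\min_k\cot\theta_{T,k}$; for $B_\eta=0$ they are no restriction.) Then $A$ is a Stieltjes matrix, i.e. $A$ is symmetric positive definite and $a_{ij}\le 0$ for $i\ne j$. Moreover all entries of $A^{-1}$ are nonnegative, and $u_1\le u_2$ in $\Omega$. -/

import Mathlib

open MeasureTheory

/-- A conforming simplicial partition of the open set `Ω ⊆ E` into finitely many `d`-simplices
(intervals for `d = 1`, triangles for `d = 2`), indexed by `ι`, which exactly captures the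
boundary of `Ω`.  The nondegenerate simplex `T` is given by its `d + 1` affinely independent
vertices `cell T 0, …, cell T d`; `(cell T).coord i` is then the `i`-th barycentric coordinate. -/
structure Mesh {E : Type*} [NormedAddCommGroup E] [InnerProductSpace ℝ E]
    (ι : Type*) (d : ℕ) (Ω : Set E) where
  cell : ι → AffineBasis (Fin (d + 1)) ℝ E
  /-- Different indices belong to different simplices. -/
  cell_injective : Function.Injective fun T => Set.range (cell T)
  /-- Two closed simplices meet in a common (possibly empty) face. -/
  conforming : ∀ S T, convexHull ℝ (Set.range (cell S)) ∩ convexHull ℝ (Set.range (cell T)) =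
    convexHull ℝ (Set.range (cell S) ∩ Set.range (cell T))
  isOpen : IsOpen Ω
  iUnion_eq : ⋃ T, convexHull ℝ (Set.range (cell T)) = closure Ω
  /-- The boundary of `Ω` is a union of faces of codimension one (nodes if `d = 1`, edges if
  `d = 2`) of the partition. -/
  boundary : ∀ x ∈ frontier Ω, ∃ T i, x ∈ convexHull ℝ (cell T '' {i}ᶜ) ∧
    convexHull ℝ (cell T '' {i}ᶜ) ⊆ frontier Ω

namespace Mesh

variable {E : Type*} [NormedAddCommGroup E] [InnerProductSpace ℝ E]
  {ι : Type*} {d : ℕ} {Ω : Set E}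

/-- The closed simplex with index `T`. -/
def elem (M : Mesh ι d Ω) (T : ι) : Set E := convexHull ℝ (Set.range (M.cell T))

/-- The interior vertices of the partition, i.e. the degrees of freedom of the homogeneous
Dirichlet problem. -/
def dof (M : Mesh ι d Ω) : Set E := {a | a ∈ Ω ∧ ∃ T i, M.cell T i = a}

theorem dof_finite [Finite ι] (M : Mesh ι d Ω) : M.dof.Finite := by
  refine (Set.finite_range fun p : ι × Fin (d + 1) => M.cell p.1 p.2).subset ?_
  rintro a ⟨-, T, i, rfl⟩
  exact ⟨(T, i), rfl⟩

noncomputable instance dofFintype [Finite ι] (M : Mesh ι d Ω) : Fintype M.dof :=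
  M.dof_finite.fintype

open Classical in
/-- The nodal basis function of the vertex `a`: on every closed simplex with vertex `a` it is the
barycentric coordinate that belongs to `a`, and it vanishes elsewhere.  The lemmas `hat_vertex`
and `hat_of_notMem` show that the choice of the simplex is immaterial. -/
noncomputable def hat (M : Mesh ι d Ω) (a x : E) : ℝ :=
  if h : ∃ p : ι × Fin (d + 1), M.cell p.1 p.2 = a ∧ x ∈ M.elem p.1 then
    (M.cell h.choose.1).coord h.choose.2 x
  else 0

theorem coord_eq_zero (B : AffineBasis (Fin (d + 1)) ℝ E) {s : Set E} {i : Fin (d + 1)}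
    (hs : s ⊆ Set.range B) (hi : B i ∉ s) {x : E} (hx : x ∈ convexHull ℝ s) :
    B.coord i x = 0 := by
  have h : convexHull ℝ s ⊆ (B.coord i) ⁻¹' {0} := by
    refine convexHull_min ?_ ((convex_singleton 0).affine_preimage _)
    intro y hy
    obtain ⟨j, rfl⟩ := hs hy
    have hij : i ≠ j := by
      rintro rfl
      exact hi hy
    simp [AffineBasis.coord_apply_ne _ hij]
  exact h hx

theorem coord_eq_coord (B C : AffineBasis (Fin (d + 1)) ℝ E) {i j : Fin (d + 1)}
    (hij : B i = C j) {x : E} (hx : x ∈ convexHull ℝ (Set.range B ∩ Set.range C)) :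
    B.coord i x = C.coord j x := by
  have h : convexHull ℝ (Set.range B ∩ Set.range C) ⊆ (B.coord i - C.coord j) ⁻¹' {0} := by
    refine convexHull_min ?_ ((convex_singleton 0).affine_preimage _)
    rintro y ⟨⟨k, rfl⟩, ⟨l, hl⟩⟩
    have hkl : i = k ↔ j = l := by
      constructor
      · rintro rfl
        exact C.ind.injective (hij.symm.trans hl.symm)
      · rintro rfl
        exact B.ind.injective (hij.trans hl)
    have h2 : C.coord j (B k) = if j = l then 1 else 0 := by rw [← hl, AffineBasis.coord_apply]
    have h1 : B.coord i (B k) = if i = k then 1 else 0 := AffineBasis.coord_apply _ _ _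
    simp [h1, h2, hkl]
  exact sub_eq_zero.1 (h hx)

theorem hat_vertex (M : Mesh ι d Ω) (T : ι) (i : Fin (d + 1)) {x : E} (hx : x ∈ M.elem T) :
    M.hat (M.cell T i) x = (M.cell T).coord i x := by
  have h : ∃ p : ι × Fin (d + 1), M.cell p.1 p.2 = M.cell T i ∧ x ∈ M.elem p.1 :=
    ⟨(T, i), rfl, hx⟩
  rw [hat, dif_pos h]
  refine coord_eq_coord _ _ h.choose_spec.1 ?_
  rw [← M.conforming]
  exact ⟨h.choose_spec.2, hx⟩

theorem hat_of_notMem (M : Mesh ι d Ω) (T : ι) {a x : E} (ha : a ∉ Set.range (M.cell T))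
    (hx : x ∈ M.elem T) : M.hat a x = 0 := by
  rw [hat]
  split_ifs with h
  · refine coord_eq_zero (M.cell h.choose.1) Set.inter_subset_left (fun hmem => ?_)
      ((M.conforming h.choose.1 T).subset ⟨h.choose_spec.2, hx⟩)
    rw [h.choose_spec.1] at hmem
    exact ha hmem.2
  · rfl

/-- The `P₁` finite element space with homogeneous Dirichlet conditions: the span of the nodal
basis functions of the interior vertices.  (Its members are functions on all of `E` that vanish
outside `Ω`.) -/
noncomputable def space (M : Mesh ι d Ω) : Submodule ℝ (E → ℝ) :=
  Submodule.span ℝ (M.hat '' M.dof)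

end Mesh

/-- The structural assumption on the lower order term `b(x, η)`, with the bound `Bη` for `∂b/∂η`:
`b` is (Lebesgue) measurable in `x ∈ Ω` for every `η`, and for a.e. `x ∈ Ω` it is `C¹` in `η` with
`0 ≤ ∂b/∂η ≤ Bη`. -/
structure LowerOrderTerm {E : Type*} [NormedAddCommGroup E] [MeasureSpace E]
    (Ω : Set E) (b : E → ℝ → ℝ) (Bη : ℝ) : Prop where
  nonneg : 0 ≤ Bη
  measurable : ∀ η, AEMeasurable (fun x => b x η) (volume.restrict Ω)
  contDiff : ∀ᵐ x ∂(volume.restrict Ω), ContDiff ℝ 1 (b x)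
  deriv_mem : ∀ᵐ x ∂(volume.restrict Ω), ∀ η, 0 ≤ deriv (b x) η ∧ deriv (b x) η ≤ Bη

namespace Mesh

variable {E : Type*} [NormedAddCommGroup E] [InnerProductSpace ℝ E] [CompleteSpace E]
  [MeasureSpace E] {ι : Type*} {d : ℕ} {Ω : Set E}

/-- The integrand `∇u · ∇v + b(x, u) v` of the weak form of `-Δu + b(x, u) = 0`.  For piecewise
affine `u` and `v` the gradients are the classical ones, which exist off the edges. -/
noncomputable def weakIntegrand (b : E → ℝ → ℝ) (u v : E → ℝ) (x : E) : ℝ :=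
  inner ℝ (gradient u x) (gradient v x) + b x (u x) * v x

/-- `u` is a subsolution of the discrete problem: `u` is in the finite element space and the weak
form is (well-defined and) nonpositive for all nonnegative discrete test functions. -/
def IsSubsolution (M : Mesh ι d Ω) (b : E → ℝ → ℝ) (u : E → ℝ) : Prop :=
  u ∈ M.space ∧ ∀ v ∈ M.space, (∀ x ∈ Ω, 0 ≤ v x) →
    IntegrableOn (weakIntegrand b u v) Ω ∧ ∫ x in Ω, weakIntegrand b u v x ≤ 0

/-- `u` is a supersolution of the discrete problem. -/
def IsSupersolution (M : Mesh ι d Ω) (b : E → ℝ → ℝ) (u : E → ℝ) : Prop :=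
  u ∈ M.space ∧ ∀ v ∈ M.space, (∀ x ∈ Ω, 0 ≤ v x) →
    IntegrableOn (weakIntegrand b u v) Ω ∧ 0 ≤ ∫ x in Ω, weakIntegrand b u v x

/-- The stiffness matrix, `s_ij = ∑_T ∫_T ∇φ_i · ∇φ_j dx`. -/
noncomputable def stiffness [Fintype ι] (M : Mesh ι d Ω) : Matrix M.dof M.dof ℝ :=
  Matrix.of fun i j => ∑ T, ∫ x in M.elem T,
    inner ℝ (gradient (M.hat i) x) (gradient (M.hat j) x)

/-- The weighted mass matrix, `m_ij = ∑_T ∫_T ∫_0^1 ∂b/∂η(x, z(t)) φ_i φ_j dt dx` with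
`z(t) = t u₁ + (1 - t) u₂`. -/
noncomputable def mass [Fintype ι] (M : Mesh ι d Ω) (b : E → ℝ → ℝ) (u₁ u₂ : E → ℝ) :
    Matrix M.dof M.dof ℝ :=
  Matrix.of fun i j => ∑ T, ∫ x in M.elem T, ∫ t in (0 : ℝ)..1,
    deriv (b x) (t * u₁ x + (1 - t) * u₂ x) * M.hat i x * M.hat j x

/-- The system matrix `A = S + M` of the linearized problem. -/
noncomputable def systemMatrix [Fintype ι] (M : Mesh ι d Ω) (b : E → ℝ → ℝ) (u₁ u₂ : E → ℝ) :
    Matrix M.dof M.dof ℝ :=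
  M.stiffness + M.mass b u₁ u₂

end Mesh

/-- A Stieltjes matrix is a real symmetric positive definite matrix whose off-diagonal entries are
nonpositive. -/
def IsStieltjes {n : Type*} [Fintype n] (A : Matrix n n ℝ) : Prop :=
  A.IsSymm ∧ A.PosDef ∧ ∀ i j, i ≠ j → A i j ≤ 0

/-- The interval `[a_{k-1}, a_k]` of a subdivision as a one-dimensional simplex. -/
noncomputable def intervalCell {n : ℕ} (a : Fin (n + 1) → ℝ) (ha : StrictMono a) (k : Fin n) :
    AffineBasis (Fin (1 + 1)) ℝ ℝ where
  toFun := ![a k.castSucc, a k.succ]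
  ind' := affineIndependent_of_ne ℝ (ha k.castSucc_lt_succ).ne
  tot' := by
    rw [(affineIndependent_of_ne ℝ (ha k.castSucc_lt_succ).ne).affineSpan_eq_top_iff_card_eq_finrank_add_one]
    simp

theorem range_intervalCell {n : ℕ} (a : Fin (n + 1) → ℝ) (ha : StrictMono a) (k : Fin n) :
    Set.range (intervalCell a ha k) = {a k.castSucc, a k.succ} := by
  change Set.range ![a k.castSucc, a k.succ] = _
  simp [Matrix.range_cons, Set.pair_comm]

theorem convexHull_intervalCell {n : ℕ} (a : Fin (n + 1) → ℝ) (ha : StrictMono a) (k : Fin n) :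
    convexHull ℝ (Set.range (intervalCell a ha k)) = Set.Icc (a k.castSucc) (a k.succ) := by
  rw [range_intervalCell, convexHull_pair, segment_eq_Icc (ha k.castSucc_lt_succ).le]

theorem Icc_inter_Icc_eq_convexHull {p q r s : ℝ} (hpq : p < q) (hqr : q ≤ r) (hrs : r < s) :
    Set.Icc p q ∩ Set.Icc r s = convexHull ℝ ({p, q} ∩ {r, s}) := by
  rcases hqr.eq_or_lt with rfl | h
  · have h1 : ({p, q} ∩ {q, s} : Set ℝ) = {q} := by
      ext x
      simp only [Set.mem_inter_iff, Set.mem_insert_iff, Set.mem_singleton_iff]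
      constructor
      · rintro ⟨rfl | rfl, h | h⟩ <;> linarith
      · rintro rfl
        simp
    rw [h1, convexHull_singleton]
    ext x
    simp only [Set.mem_inter_iff, Set.mem_Icc, Set.mem_singleton_iff]
    constructor
    · rintro ⟨⟨_, _⟩, _, _⟩
      linarith
    · rintro rfl
      exact ⟨⟨hpq.le, le_rfl⟩, le_rfl, hrs.le⟩
  · have h1 : ({p, q} ∩ {r, s} : Set ℝ) = ∅ := by
      ext x
      simp only [Set.mem_inter_iff, Set.mem_insert_iff, Set.mem_singleton_iff,
        Set.mem_empty_iff_false, iff_false]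
      rintro ⟨rfl | rfl, h' | h'⟩ <;> linarith
    rw [h1, convexHull_empty]
    ext x
    simp only [Set.mem_inter_iff, Set.mem_Icc, Set.mem_empty_iff_false, iff_false]
    rintro ⟨⟨_, _⟩, _, _⟩
    linarith

theorem exists_mem_Icc_of_subdivision {n : ℕ} (a : Fin (n + 1) → ℝ) (ha : StrictMono a)
    (h0 : 0 < n) {x : ℝ} (hx : x ∈ Set.Icc (a 0) (a (Fin.last n))) :
    ∃ k : Fin n, x ∈ Set.Icc (a k.castSucc) (a k.succ) := by
  have key : ∀ j : Fin (n + 1), x ≤ a j →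
      x = a 0 ∨ ∃ k : Fin n, x ∈ Set.Icc (a k.castSucc) (a k.succ) := by
    intro j
    induction j using Fin.induction with
    | zero => exact fun h => Or.inl (le_antisymm h hx.1)
    | succ k ih =>
      intro h
      rcases le_total x (a k.castSucc) with h' | h'
      · exact ih h'
      · exact Or.inr ⟨k, h', h⟩
  rcases key _ hx.2 with rfl | h
  · exact ⟨⟨0, h0⟩, le_rfl, ha.monotone (Fin.zero_le _)⟩
  · exact h

/-- The subdivision `α = a₀ < a₁ < … < a_n = β` of the interval `(α, β)`. -/
noncomputable def intervalMesh {n : ℕ} (a : Fin (n + 1) → ℝ) (ha : StrictMono a) :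
    Mesh (Fin n) 1 (Set.Ioo (a 0) (a (Fin.last n))) where
  cell := intervalCell a ha
  cell_injective := by
    intro S T h
    have h' : Set.Icc (a S.castSucc) (a S.succ) = Set.Icc (a T.castSucc) (a T.succ) := by
      rw [← convexHull_intervalCell a ha, ← convexHull_intervalCell a ha]
      exact congrArg (convexHull ℝ) h
    have h1 := ((Set.Icc_eq_Icc_iff (ha S.castSucc_lt_succ).le).1 h').1
    exact Fin.castSucc_injective n (ha.injective h1)
  conforming := by
    intro S T
    rcases lt_trichotomy S T with h | rfl | h
    · rw [convexHull_intervalCell, convexHull_intervalCell, range_intervalCell,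
        range_intervalCell]
      exact Icc_inter_Icc_eq_convexHull (ha S.castSucc_lt_succ)
        (ha.monotone (Fin.succ_le_castSucc_iff.2 h)) (ha T.castSucc_lt_succ)
    · simp
    · rw [convexHull_intervalCell, convexHull_intervalCell, range_intervalCell,
        range_intervalCell, Set.inter_comm, Set.inter_comm {a S.castSucc, a S.succ}]
      exact Icc_inter_Icc_eq_convexHull (ha T.castSucc_lt_succ)
        (ha.monotone (Fin.succ_le_castSucc_iff.2 h)) (ha S.castSucc_lt_succ)
  isOpen := isOpen_Ioo
  iUnion_eq := by
    simp only [convexHull_intervalCell]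
    rcases Nat.eq_zero_or_pos n with rfl | h0
    · simp
    · rw [closure_Ioo (ha (by simpa [Fin.lt_def] using h0)).ne]
      ext x
      rw [Set.mem_iUnion]
      constructor
      · rintro ⟨k, hk⟩
        exact ⟨(ha.monotone (Fin.zero_le _)).trans hk.1,
          hk.2.trans (ha.monotone (Fin.le_last _))⟩
      · exact exists_mem_Icc_of_subdivision a ha h0
  boundary := by
    intro x hx
    rcases n with _ | n
    · simp at hx
    · have hlt : a 0 < a (Fin.last (n + 1)) := ha (by simp [Fin.lt_def])
      have hc0 : ({1}ᶜ : Set (Fin (1 + 1))) = {0} := by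
        ext i
        fin_cases i <;> simp
      have hc1 : ({0}ᶜ : Set (Fin (1 + 1))) = {1} := by
        ext i
        fin_cases i <;> simp
      rw [frontier_Ioo hlt] at hx ⊢
      rcases hx with rfl | hx
      · refine ⟨0, 1, ?_⟩
        have h : intervalCell a ha 0 0 = a 0 := rfl
        rw [hc0, Set.image_singleton, convexHull_singleton, h]
        simp
      · rw [Set.mem_singleton_iff] at hx
        subst hx
        refine ⟨Fin.last n, 0, ?_⟩
        have h : intervalCell a ha (Fin.last n) 1 = a (Fin.last (n + 1)) := rfl
        rw [hc1, Set.image_singleton, convexHull_singleton, h]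
        simp

/-- The interior angle of the triangle `T` at its vertex `k`. -/
noncomputable def triangleAngle
    (T : AffineBasis (Fin 3) ℝ (EuclideanSpace ℝ (Fin 2))) (k : Fin 3) : ℝ :=
  EuclideanGeometry.angle (T (k + 1)) (T k) (T (k + 2))

/-- Mesh regularity: the angles are bounded away from `0` and from `π / 2`. -/
def MeshRegular {ι : Type*} {Ω : Set (EuclideanSpace ℝ (Fin 2))} (M : Mesh ι 2 Ω) : Prop :=
  ∃ tmin tmax : ℝ, 0 < tmin ∧ tmin ≤ tmax ∧ tmax < Real.pi / 2 ∧
    ∀ T k, tmin ≤ triangleAngle (M.cell T) k ∧ triangleAngle (M.cell T) k ≤ tmax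

/-!
By the mean value theorem in integral form, `b(x, u₂) - b(x, u₁) = c(x) (u₂ - u₁)` with
`0 ≤ c ≤ Bη`, so `A` is the Galerkin matrix of the linear operator `-Δ + c`, and `A` maps the nodal
values of `u₂ - u₁` to a nonnegative vector.  It therefore suffices that `A` is a Stieltjes matrix,
because such a matrix is inverse-monotone.  For definiteness, a function of `𝒱` with vanishing
gradient takes finitely many values, hence is constant by continuity, and it is `0` off `Ω`.  For
the off-diagonal signs, an element `T` with barycentric coordinates `λ` contributes at most
`|T| (∇λₖ ⬝ ∇λₗ + Bη / ((d + 1) (d + 2)))`, where `∇λₖ ⬝ ∇λₗ` is `-1 / h ^ 2` on an interval of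
length `h` and `-cot θ / (2 |T|)` on a triangle whose angle opposite to the edge `kl` is `θ`.
-/

section AffineTransvection

variable {V : Type*} [AddCommGroup V] [Module ℝ V]

/-- The map `x ↦ x + f x • w`, whose linear part has determinant `1 + f.linear w`.  Swapping two
vertices of a simplex and mapping a simplex onto one of its halves are of this form. -/
noncomputable def affineTransvection (f : V →ᵃ[ℝ] ℝ) (w : V) : V →ᵃ[ℝ] V where
  toFun x := x + f x • w
  linear := LinearMap.transvection f.linear w
  map_vadd' p v := by
    rw [f.map_vadd, LinearMap.transvection.apply]
    simp only [vadd_eq_add, add_smul]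
    abel

theorem affineMap_affineTransvection (g f : V →ᵃ[ℝ] ℝ) (w x : V) :
    g (affineTransvection f w x) = g x + f x * g.linear w := by
  have h := g.map_vadd x (f x • w)
  rw [map_smul, smul_eq_mul, vadd_eq_add, vadd_eq_add, add_comm, add_comm _ (g x)] at h
  exact h

theorem det_affineTransvection [FiniteDimensional ℝ V] {f : V →ᵃ[ℝ] ℝ} {w : V} :
    LinearMap.det (affineTransvection f w).linear = 1 + f.linear w :=
  LinearMap.transvection.det _ _

variable {κ : Type*} (B : AffineBasis κ ℝ V)

theorem linear_coord_sub [DecidableEq κ] (i j k : κ) :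
    (B.coord i).linear (B j - B k) = (if i = j then 1 else 0) - if i = k then 1 else 0 := by
  rw [← vsub_eq_sub, AffineMap.linearMap_vsub, B.coord_apply, B.coord_apply, vsub_eq_sub]

theorem one_add_coord_sub_coord_linear {k l : κ} (hkl : k ≠ l) :
    1 + (B.coord k - B.coord l).linear (B l - B k) = -1 := by
  classical
  simp only [AffineMap.sub_linear, LinearMap.sub_apply, linear_coord_sub, if_true, hkl,
    hkl.symm, if_false]
  norm_num

/-- The affine involution that swaps the vertices `k` and `l` and fixes the others. -/
noncomputable def vertexSwap (k l : κ) : V →ᵃ[ℝ] V :=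
  affineTransvection (B.coord k - B.coord l) (B l - B k)

/-- The affine map that sends the vertex `l` to the midpoint of the edge `k l` and fixes the other
vertices, i.e. maps the simplex onto the half of it that is adjacent to `k`. -/
noncomputable def edgeBisection (k l : κ) : V →ᵃ[ℝ] V :=
  affineTransvection (B.coord l) ((2⁻¹ : ℝ) • (B k - B l))

theorem coord_vertexSwap [DecidableEq κ] (k l i : κ) (x : V) :
    B.coord i (vertexSwap B k l x) = B.coord (Equiv.swap k l i) x := by
  rw [vertexSwap, affineMap_affineTransvection, linear_coord_sub, Equiv.swap_apply_def]
  simp only [AffineMap.coe_sub, Pi.sub_apply]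
  split_ifs <;> simp_all

theorem coord_edgeBisection [DecidableEq κ] (k l i : κ) (x : V) :
    B.coord i (edgeBisection B k l x) =
      B.coord i x + B.coord l x / 2 * ((if i = k then 1 else 0) - if i = l then 1 else 0) := by
  rw [edgeBisection, affineMap_affineTransvection, map_smul, linear_coord_sub, smul_eq_mul]
  ring

theorem vertexSwap_preimage (k l : κ) :
    vertexSwap B k l ⁻¹' convexHull ℝ (Set.range B) = convexHull ℝ (Set.range B) := by
  classical
  ext x
  simp only [B.convexHull_eq_nonneg_coord, Set.preimage_ofPred_eq, Set.mem_ofPred_eq,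
    coord_vertexSwap]
  exact (Equiv.swap k l).forall_congr_left.trans (by simp)

theorem edgeBisection_preimage {k l : κ} (hkl : k ≠ l) :
    edgeBisection B k l ⁻¹' (convexHull ℝ (Set.range B) ∩ {x | 0 ≤ (B.coord k - B.coord l) x}) =
      convexHull ℝ (Set.range B) := by
  classical
  ext x
  simp only [B.convexHull_eq_nonneg_coord, Set.mem_preimage, Set.mem_inter_iff,
    Set.mem_ofPred_eq, coord_edgeBisection, AffineMap.coe_sub, Pi.sub_apply]
  constructor
  · rintro ⟨hnonneg, hle⟩ i
    have hi := hnonneg i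
    simp only [if_neg hkl, if_neg hkl.symm, if_true] at hle
    rcases eq_or_ne i l with rfl | hil
    · simp only [if_neg hkl.symm, if_true] at hi
      linarith
    · rcases eq_or_ne i k with rfl | hik
      · linarith
      · simpa only [if_neg hil, if_neg hik, sub_zero, mul_zero, add_zero] using hi
  · intro hnonneg
    have hl := hnonneg l
    refine ⟨fun i => ?_, ?_⟩
    · have hi := hnonneg i
      rcases eq_or_ne i l with rfl | hil
      · simp only [if_neg hkl.symm, if_true]
        linarith
      · simp only [if_neg hil]
        split_ifs <;> linarith
    · have hk := hnonneg k
      simp only [if_neg hkl, if_neg hkl.symm, if_true]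
      linarith

end AffineTransvection

section AffineMeasure

variable {E : Type*} [NormedAddCommGroup E] [NormedSpace ℝ E] [FiniteDimensional ℝ E]
  [MeasurableSpace E] [BorelSpace E]

theorem measurableEmbedding_affineMap {Φ : E →ᵃ[ℝ] E} (hΦ : LinearMap.det Φ.linear ≠ 0) :
    MeasurableEmbedding Φ := by
  have hinj : Function.Injective Φ := by
    rw [← Φ.linear_injective_iff]
    exact (LinearMap.equivOfDetNeZero Φ.linear hΦ).injective
  exact Φ.continuous_of_finiteDimensional.measurableEmbedding hinj

variable (μ : Measure E) [μ.IsAddHaarMeasure]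

theorem map_affineMap_addHaar_eq_smul_addHaar {Φ : E →ᵃ[ℝ] E}
    (hΦ : LinearMap.det Φ.linear ≠ 0) :
    μ.map Φ = ENNReal.ofReal |(LinearMap.det Φ.linear)⁻¹| • μ := by
  have hdecomp : (Φ : E → E) = (· + Φ 0) ∘ Φ.linear := Φ.decomp
  rw [hdecomp, ← Measure.map_map (measurable_add_const _)
    (Φ.linear.continuous_of_finiteDimensional).measurable,
    Measure.map_linearMap_addHaar_eq_smul_addHaar μ hΦ, Measure.map_smul,
    map_add_right_eq_self]

variable {f : E →ᵃ[ℝ] ℝ} {w : E}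

theorem measurableEmbedding_affineTransvection (hw : 1 + f.linear w ≠ 0) :
    MeasurableEmbedding (affineTransvection f w) :=
  measurableEmbedding_affineMap (det_affineTransvection.trans_ne hw)

theorem map_affineTransvection_addHaar (hw : 1 + f.linear w ≠ 0) :
    μ.map (affineTransvection f w) = ENNReal.ofReal |(1 + f.linear w)⁻¹| • μ := by
  rw [map_affineMap_addHaar_eq_smul_addHaar μ (det_affineTransvection.trans_ne hw),
    det_affineTransvection]

theorem setIntegral_affineTransvection (hw : 1 + f.linear w ≠ 0) (s : Set E) (g : E → ℝ) :
    |1 + f.linear w| * ∫ x in affineTransvection f w ⁻¹' s, g (affineTransvection f w x) ∂μ =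
      ∫ x in s, g x ∂μ := by
  rw [← (measurableEmbedding_affineTransvection hw).setIntegral_map,
    map_affineTransvection_addHaar μ hw, Measure.restrict_smul, integral_smul_measure,
    ENNReal.toReal_ofReal (abs_nonneg _), abs_inv, smul_eq_mul,
    mul_inv_cancel_left₀ (abs_ne_zero.2 hw)]

theorem ae_affineMap_ne_zero {f : E →ᵃ[ℝ] ℝ} (hf : f ≠ 0) : ∀ᵐ x ∂μ, f x ≠ 0 := by
  have htop : (affineSpan ℝ {(0 : ℝ)}).comap f ≠ ⊤ := by
    refine fun h => hf (AffineMap.ext fun x => ?_)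
    have hx : x ∈ (affineSpan ℝ {(0 : ℝ)}).comap f := h ▸ AffineSubspace.mem_top ℝ E x
    simpa using hx
  refine measure_mono_null (fun x hx => ?_) (Measure.addHaar_affineSubspace μ _ htop)
  simpa using hx

end AffineMeasure

/-- A measure preserving symmetry of `s` and `g` that changes the sign of `f` maps the part of `s`
where `f ≤ 0` onto the part where `0 ≤ f`. -/
theorem setIntegral_eq_two_mul_of_symm {α : Type*} [MeasurableSpace α] {μ : Measure α} {σ : α → α}
    (hσ : MeasurePreserving σ μ μ) (hσ' : MeasurableEmbedding σ) {s : Set α} {f g : α → ℝ}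
    (hs : σ ⁻¹' s = s) (hf : ∀ x, f (σ x) = -f x) (hg : ∀ x, g (σ x) = g x)
    (hfm : Measurable f) (hf0 : ∀ᵐ x ∂μ, f x ≠ 0) (hgs : IntegrableOn g s μ) :
    ∫ x in s, g x ∂μ = 2 * ∫ x in s ∩ {x | 0 ≤ f x}, g x ∂μ := by
  have hcompl : (s ∩ {x | f x ≤ 0} : Set α) =ᵐ[μ] (s \ {x | 0 ≤ f x} : Set α) := by
    filter_upwards [hf0] with x hx
    exact propext (and_congr_right fun _ => (hx.le_iff_lt (α := ℝ)).trans not_le.symm)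
  have hhalf : ∫ x in s ∩ {x | f x ≤ 0}, g x ∂μ = ∫ x in s ∩ {x | 0 ≤ f x}, g x ∂μ := by
    rw [← hσ.setIntegral_preimage_emb hσ', Set.preimage_inter, hs]
    simp only [hg, Set.preimage_ofPred_eq, hf, Left.neg_nonpos_iff]
  rw [← integral_inter_add_sdiff (measurableSet_le measurable_const hfm) hgs,
    ← setIntegral_congr_set hcompl, hhalf, two_mul]

section SimplexIntegrals

variable {E : Type*} [NormedAddCommGroup E] [NormedSpace ℝ E] [MeasurableSpace E] [BorelSpace E]
  (μ : Measure E) [μ.IsAddHaarMeasure] {κ : Type*} (B : AffineBasis κ ℝ E)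

theorem integrableOn_simplex [Finite κ] {g : E → ℝ} (hg : Continuous g) :
    IntegrableOn g (convexHull ℝ (Set.range B)) μ :=
  hg.continuousOn.integrableOn_compact ((Set.finite_range B).isCompact_convexHull ℝ)

variable [FiniteDimensional ℝ E] {k l : κ}

theorem measurableEmbedding_vertexSwap (hkl : k ≠ l) : MeasurableEmbedding (vertexSwap B k l) :=
  measurableEmbedding_affineTransvection
    ((one_add_coord_sub_coord_linear B hkl).trans_ne (by norm_num))

theorem measurePreserving_vertexSwap (hkl : k ≠ l) :
    MeasurePreserving (vertexSwap B k l) μ μ := by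
  refine ⟨(measurableEmbedding_vertexSwap B hkl).measurable, ?_⟩
  have hdet := one_add_coord_sub_coord_linear B hkl
  rw [vertexSwap, map_affineTransvection_addHaar μ (hdet.trans_ne (by norm_num)), hdet]
  simp

theorem setIntegral_vertexSwap (hkl : k ≠ l) (g : E → ℝ) :
    ∫ x in convexHull ℝ (Set.range B), g (vertexSwap B k l x) ∂μ =
      ∫ x in convexHull ℝ (Set.range B), g x ∂μ := by
  conv_lhs => rw [← vertexSwap_preimage B k l]
  exact (measurePreserving_vertexSwap μ B hkl).setIntegral_preimage_emb
    (measurableEmbedding_vertexSwap B hkl) g _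

theorem setIntegral_coord_eq (k l : κ) :
    ∫ x in convexHull ℝ (Set.range B), B.coord k x ∂μ =
      ∫ x in convexHull ℝ (Set.range B), B.coord l x ∂μ := by
  classical
  rcases eq_or_ne k l with rfl | hkl
  · rfl
  · rw [← setIntegral_vertexSwap μ B hkl]
    simp only [coord_vertexSwap, Equiv.swap_apply_left]

theorem setIntegral_coord_mul_coord_eq {k l m : κ} (hkl : k ≠ l) (hkm : k ≠ m) :
    ∫ x in convexHull ℝ (Set.range B), B.coord k x * B.coord m x ∂μ =
      ∫ x in convexHull ℝ (Set.range B), B.coord k x * B.coord l x ∂μ := by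
  classical
  rcases eq_or_ne l m with rfl | hlm
  · rfl
  · rw [← setIntegral_vertexSwap μ B hlm]
    simp only [coord_vertexSwap, Equiv.swap_apply_right, Equiv.swap_apply_of_ne_of_ne hkl hkm]

theorem setIntegral_edgeBisection [Finite κ] (hkl : k ≠ l) {g : E → ℝ} (hg : Continuous g)
    (hsymm : ∀ x, g (vertexSwap B k l x) = g x) :
    ∫ x in convexHull ℝ (Set.range B), g (edgeBisection B k l x) ∂μ =
      ∫ x in convexHull ℝ (Set.range B), g x ∂μ := by
  classical
  have hdet : 1 + (B.coord l).linear ((2⁻¹ : ℝ) • (B k - B l)) = 2⁻¹ := by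
    rw [map_smul, linear_coord_sub, if_neg hkl.symm, if_pos rfl]
    norm_num
  have hdiff : B.coord k - B.coord l ≠ 0 := by
    intro h
    have := one_add_coord_sub_coord_linear B hkl
    rw [h] at this
    norm_num at this
  have hswap (x : E) : (B.coord k - B.coord l) (vertexSwap B k l x) =
      -(B.coord k - B.coord l) x := by
    simp [coord_vertexSwap]
  have hhalf := setIntegral_affineTransvection μ (hdet.trans_ne (by norm_num))
    (convexHull ℝ (Set.range B) ∩ {x | 0 ≤ (B.coord k - B.coord l) x}) g
  rw [← edgeBisection, edgeBisection_preimage B hkl, hdet, abs_of_pos (by norm_num)] at hhalf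
  rw [setIntegral_eq_two_mul_of_symm (measurePreserving_vertexSwap μ B hkl)
    (measurableEmbedding_vertexSwap B hkl) (vertexSwap_preimage B k l) hswap hsymm
    (AffineMap.continuous_of_finiteDimensional _).measurable
    (ae_affineMap_ne_zero μ hdiff) (integrableOn_simplex μ B hg), ← hhalf,
    mul_inv_cancel_left₀ two_ne_zero]

/-- Bisecting the edge `k l` leaves the integral of `λₖ λₗ` unchanged and turns its integrand into
`λₖ λₗ / 2 + λₗ² / 4`. -/
theorem setIntegral_coord_mul_self [Finite κ] (hkl : k ≠ l) :
    ∫ x in convexHull ℝ (Set.range B), B.coord k x * B.coord k x ∂μ =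
      2 * ∫ x in convexHull ℝ (Set.range B), B.coord k x * B.coord l x ∂μ := by
  classical
  have hcont (i : κ) : Continuous (B.coord i) := AffineMap.continuous_of_finiteDimensional _
  have hbisect := setIntegral_edgeBisection μ B hkl.symm
    (g := fun x => B.coord k x * B.coord l x) (by fun_prop)
    (fun x => by simp [coord_vertexSwap, mul_comm])
  have hexpand (x : E) : B.coord k (edgeBisection B l k x) * B.coord l (edgeBisection B l k x) =
      B.coord k x * B.coord l x / 2 + B.coord k x * B.coord k x / 4 := by
    simp only [coord_edgeBisection, if_neg hkl, if_neg hkl.symm, if_true]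
    ring
  simp only [hexpand] at hbisect
  rw [integral_add (integrableOn_simplex μ B (by fun_prop))
    (integrableOn_simplex μ B (by fun_prop)), integral_div, integral_div] at hbisect
  linarith

variable [Fintype κ]

theorem card_mul_setIntegral_coord (k : κ) :
    Fintype.card κ * ∫ x in convexHull ℝ (Set.range B), B.coord k x ∂μ =
      μ.real (convexHull ℝ (Set.range B)) := by
  have hcont (i : κ) : Continuous (B.coord i) := AffineMap.continuous_of_finiteDimensional _
  calc Fintype.card κ * ∫ x in convexHull ℝ (Set.range B), B.coord k x ∂μ
      = ∑ i, ∫ x in convexHull ℝ (Set.range B), B.coord i x ∂μ := by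
        rw [Finset.sum_congr rfl fun i _ => setIntegral_coord_eq μ B i k]
        simp
    _ = ∫ x in convexHull ℝ (Set.range B), ∑ i, B.coord i x ∂μ :=
        (integral_finsetSum _ fun i _ => integrableOn_simplex μ B (hcont i)).symm
    _ = μ.real (convexHull ℝ (Set.range B)) := by
        simp [B.sum_coord_apply_eq_one]

theorem setIntegral_coord_eq_mul (hkl : k ≠ l) :
    ∫ x in convexHull ℝ (Set.range B), B.coord k x ∂μ =
      (Fintype.card κ + 1) * ∫ x in convexHull ℝ (Set.range B), B.coord k x * B.coord l x ∂μ := by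
  classical
  have hcont (i : κ) : Continuous (B.coord i) := AffineMap.continuous_of_finiteDimensional _
  have hoff (i : κ) (hi : i ∈ Finset.univ.erase k) :=
    setIntegral_coord_mul_coord_eq μ B hkl (Finset.ne_of_mem_erase hi).symm
  calc ∫ x in convexHull ℝ (Set.range B), B.coord k x ∂μ
      = ∫ x in convexHull ℝ (Set.range B), ∑ i, B.coord k x * B.coord i x ∂μ := by
        simp only [← Finset.mul_sum, B.sum_coord_apply_eq_one, mul_one]
    _ = ∑ i, ∫ x in convexHull ℝ (Set.range B), B.coord k x * B.coord i x ∂μ :=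
        integral_finsetSum _ fun i _ => integrableOn_simplex μ B (by fun_prop)
    _ = _ := by
        rw [← Finset.add_sum_erase _ _ (Finset.mem_univ k), setIntegral_coord_mul_self μ B hkl,
          Finset.sum_congr rfl hoff, Finset.sum_const, Finset.card_erase_of_mem (Finset.mem_univ k),
          Finset.card_univ, nsmul_eq_mul, Nat.cast_pred (Fintype.card_pos_iff.2 ⟨k⟩)]
        ring

theorem setIntegral_coord_mul_coord (hkl : k ≠ l) :
    ∫ x in convexHull ℝ (Set.range B), B.coord k x * B.coord l x ∂μ =
      μ.real (convexHull ℝ (Set.range B)) / (Fintype.card κ * (Fintype.card κ + 1)) := by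
  have hcard : (Fintype.card κ : ℝ) ≠ 0 := Nat.cast_ne_zero.2 (Fintype.card_pos_iff.2 ⟨k⟩).ne'
  rw [← card_mul_setIntegral_coord μ B k, setIntegral_coord_eq_mul μ B hkl,
    mul_div_mul_left _ _ hcard, mul_div_cancel_left₀ _ (by positivity)]

end SimplexIntegrals

section Dslope

variable {f : ℝ → ℝ}

theorem exists_deriv_eq_dslope (hf : Differentiable ℝ f) (a b : ℝ) :
    ∃ c, deriv f c = dslope f a b := by
  rcases lt_trichotomy a b with hab | rfl | hab
  · obtain ⟨c, -, hc⟩ :=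
      exists_deriv_eq_slope' f hab hf.continuous.continuousOn hf.differentiableOn
    exact ⟨c, by rw [hc, dslope_of_ne _ hab.ne']⟩
  · exact ⟨a, (dslope_same _ _).symm⟩
  · obtain ⟨c, -, hc⟩ :=
      exists_deriv_eq_slope' f hab hf.continuous.continuousOn hf.differentiableOn
    exact ⟨c, by rw [hc, dslope_of_ne _ hab.ne, slope_comm]⟩

theorem integral_deriv_segment_eq_dslope (hf : ContDiff ℝ 1 f) (a b : ℝ) :
    ∫ t in (0 : ℝ)..1, deriv f (t * b + (1 - t) * a) = dslope f a b := by
  have hsegment : ∀ t : ℝ, t * b + (1 - t) * a = (b - a) * t + a := fun t => by ring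
  simp only [hsegment]
  rcases eq_or_ne b a with rfl | hab
  · simp [dslope_same]
  · rw [intervalIntegral.integral_comp_mul_add _ (sub_ne_zero.2 hab), mul_zero, mul_one, zero_add,
      sub_add_cancel, intervalIntegral.integral_deriv_eq_sub
        (fun t _ => hf.differentiable one_ne_zero t)
        ((hf.continuous_deriv le_rfl).intervalIntegrable _ _),
      dslope_of_ne _ hab, slope_def_module]

theorem tendsto_slope_dslope (hf : Differentiable ℝ f) (a b : ℝ) :
    Filter.Tendsto (slope f a) (nhdsWithin b {b}ᶜ) (nhds (dslope f a b)) := by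
  have hcont : ContinuousAt (dslope f a) b := by
    rcases eq_or_ne b a with rfl | hab
    · exact continuousAt_dslope_same.2 (hf b)
    · exact (continuousAt_dslope_of_ne hab).2 hf.continuous.continuousAt
  have hne : ∀ᶠ y in nhdsWithin b {b}ᶜ, y ≠ a := by
    rcases eq_or_ne b a with rfl | hab
    · exact self_mem_nhdsWithin
    · exact nhdsWithin_le_nhds (isOpen_ne.mem_nhds hab)
  exact (hcont.tendsto.mono_left nhdsWithin_le_nhds).congr'
    (hne.mono fun y hy => dslope_of_ne _ hy)

end Dslope

section Caratheodory

variable {α : Type*} [MeasurableSpace α] {μ : Measure α}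

theorem aemeasurable_comp_of_ae_continuous {β γ : Type*} [TopologicalSpace β] [TopologicalSpace γ]
    [TopologicalSpace.PseudoMetrizableSpace γ] [MeasurableSpace γ] [BorelSpace γ] {g : α → β → γ}
    (hg : ∀ y, AEMeasurable (fun x => g x y) μ) (hcont : ∀ᵐ x ∂μ, Continuous (g x)) {v : α → β}
    (hv : StronglyMeasurable v) : AEMeasurable (fun x => g x (v x)) μ := by
  refine aemeasurable_of_tendsto_metrizable_ae Filter.atTop
    (f := fun n x => g x (hv.approx n x)) (fun n => ?_) ?_
  · have hfibres : ⋃ y : Set.range (hv.approx n), hv.approx n ⁻¹' {(y : β)} = Set.univ :=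
      Set.eq_univ_of_forall fun x => Set.mem_iUnion.2 ⟨⟨_, x, rfl⟩, rfl⟩
    have := (hv.approx n).finite_range.countable.to_subtype
    rw [← Measure.restrict_univ (μ := μ), ← hfibres, aemeasurable_iUnion_iff]
    refine fun y => (hg y).restrict.congr ?_
    filter_upwards [ae_restrict_mem ((hv.approx n).measurableSet_fiber y)] with x hx
    rw [Set.mem_singleton_iff.1 hx]
  · filter_upwards [hcont] with x hx
    exact (hx.tendsto _).comp (hv.tendsto_approx x)

theorem aemeasurable_dslope {g : α → ℝ → ℝ} (hg : ∀ y, AEMeasurable (fun x => g x y) μ)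
    (hdiff : ∀ᵐ x ∂μ, Differentiable ℝ (g x)) {p q : α → ℝ} (hp : Measurable p)
    (hq : Measurable q) : AEMeasurable (fun x => dslope (g x) (p x) (q x)) μ := by
  have hcomp : ∀ {v : α → ℝ}, Measurable v → AEMeasurable (fun x => g x (v x)) μ := fun hv =>
    aemeasurable_comp_of_ae_continuous hg (hdiff.mono fun _ h => h.continuous) hv.stronglyMeasurable
  let shifted (n : ℕ) (x : α) : ℝ := q x + 1 / ((n : ℝ) + 1)
  have hshifted : ∀ n, Measurable (shifted n) := fun n => hq.add_const _
  refine aemeasurable_of_tendsto_metrizable_ae Filter.atTop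
    (f := fun n x => slope (g x) (p x) (shifted n x)) (fun n => ?_) ?_
  · exact ((hshifted n).sub hp).inv.aemeasurable.smul ((hcomp (hshifted n)).sub (hcomp hp))
  · filter_upwards [hdiff] with x hx
    refine (tendsto_slope_dslope hx (p x) (q x)).comp (tendsto_nhdsWithin_iff.2 ⟨?_, ?_⟩)
    · simpa only [add_zero] using tendsto_one_div_add_atTop_nhds_zero_nat.const_add (q x)
    · exact Filter.Eventually.of_forall fun n => by simpa [shifted] using Nat.cast_add_one_ne_zero n

end Caratheodory

/-- `c` is a measurable coefficient on `Ω` with values in `[0, B]`, so that `-Δ + c` is a coercive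
and bounded reaction–diffusion operator. -/
structure IsReactionCoefficient {E : Type*} [MeasureSpace E] (Ω : Set E) (c : E → ℝ) (B : ℝ) :
    Prop where
  aestronglyMeasurable : AEStronglyMeasurable c (volume.restrict Ω)
  ae_mem_Icc : ∀ᵐ x ∂volume.restrict Ω, c x ∈ Set.Icc 0 B

theorem LowerOrderTerm.isReactionCoefficient_dslope {E : Type*} [NormedAddCommGroup E]
    [MeasureSpace E] {Ω : Set E} {b : E → ℝ → ℝ} {B : ℝ} {u₁ u₂ : E → ℝ}
    (hb : LowerOrderTerm Ω b B) (h₁ : Measurable u₁)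
    (h₂ : Measurable u₂) :
    IsReactionCoefficient Ω (fun x => dslope (b x) (u₂ x) (u₁ x)) B where
  aestronglyMeasurable := (aemeasurable_dslope hb.measurable
    (hb.contDiff.mono fun _ hx => hx.differentiable one_ne_zero) h₂ h₁).aestronglyMeasurable
  ae_mem_Icc := by
    filter_upwards [hb.contDiff, hb.deriv_mem] with x hx hderiv
    obtain ⟨η, hη⟩ := exists_deriv_eq_dslope (hx.differentiable one_ne_zero) (u₂ x) (u₁ x)
    exact hη ▸ hderiv η

section Stieltjes

open Matrix

variable {n : Type*} [Fintype n] {A : Matrix n n ℝ}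

theorem IsStieltjes.nonneg_of_mulVec_nonneg (hA : IsStieltjes A) {x : n → ℝ}
    (hx : 0 ≤ A *ᵥ x) : 0 ≤ x := by
  obtain ⟨-, hpos, hoff⟩ := hA
  have hmixed : x⁻ ⬝ᵥ A *ᵥ x⁺ ≤ 0 := by
    simp only [dotProduct, mulVec, Finset.mul_sum]
    refine Finset.sum_nonpos fun i _ => Finset.sum_nonpos fun j _ => ?_
    rw [mul_left_comm]
    rcases eq_or_ne i j with rfl | hij
    · have hi : x⁻ i * x⁺ i = 0 := by
        rw [Pi.negPart_apply, Pi.posPart_apply, mul_eq_zero, negPart_eq_zero, posPart_eq_zero]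
        exact le_total 0 (x i)
      rw [hi, mul_zero]
    · exact mul_nonpos_of_nonpos_of_nonneg (hoff i j hij)
        (mul_nonneg (negPart_nonneg x i) (posPart_nonneg x j))
  have htest : 0 ≤ x⁻ ⬝ᵥ A *ᵥ x := dotProduct_nonneg_of_nonneg (negPart_nonneg x) hx
  have hsplit : x⁻ ⬝ᵥ A *ᵥ x = x⁻ ⬝ᵥ A *ᵥ x⁺ - x⁻ ⬝ᵥ A *ᵥ x⁻ := by
    rw [← dotProduct_sub, ← mulVec_sub, posPart_sub_negPart]
  by_contra hneg
  have hneg' : x⁻ ≠ 0 := fun h => hneg (negPart_eq_zero.1 h)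
  have hquad : 0 < x⁻ ⬝ᵥ A *ᵥ x⁻ := by simpa using hpos.dotProduct_mulVec_pos hneg'
  linarith

theorem IsStieltjes.inv_nonneg [DecidableEq n] (hA : IsStieltjes A) (i j : n) :
    0 ≤ A⁻¹ i j := by
  refine hA.nonneg_of_mulVec_nonneg (x := A⁻¹ *ᵥ Pi.single j 1) ?_ i |>.trans_eq ?_
  · rw [mulVec_mulVec, mul_nonsing_inv A (isUnit_iff_ne_zero.2 hA.2.1.det_pos.ne'), one_mulVec]
    exact Pi.single_nonneg.2 zero_le_one
  · rw [mulVec_single_one, col_apply]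

end Stieltjes

section AffineGradient

variable {E : Type*} [NormedAddCommGroup E] [InnerProductSpace ℝ E] [FiniteDimensional ℝ E]

/-- The gradient of an affine function as a linear map of the function; it is characterized by
`inner_affineGradient`. -/
noncomputable def affineGradient : (E →ᵃ[ℝ] ℝ) →ₗ[ℝ] E where
  toFun f := (InnerProductSpace.toDual ℝ E).symm (LinearMap.toContinuousLinearMap f.linear)
  map_add' f g := by simp only [AffineMap.add_linear, map_add]
  map_smul' r f := by simp

theorem inner_affineGradient (f : E →ᵃ[ℝ] ℝ) (v : E) :
    inner ℝ (affineGradient f) v = f.linear v := by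
  simp [affineGradient]

theorem hasGradientAt_affineMap (f : E →ᵃ[ℝ] ℝ) (x : E) :
    HasGradientAt f (affineGradient f) x := by
  have hf : (f : E → ℝ) = fun y => LinearMap.toContinuousLinearMap f.linear y + f 0 := by
    ext y
    exact congrFun f.decomp y
  rw [hasGradientAt_iff_hasFDerivAt, hf]
  convert! (ContinuousLinearMap.hasFDerivAt _).add_const (f 0)
  exact LinearIsometryEquiv.apply_symm_apply _ _

theorem hasGradientAt_of_eqOn_affineMap {s : Set E} {v : E → ℝ} {f : E →ᵃ[ℝ] ℝ}
    (hv : Set.EqOn v f s) {x : E} (hx : x ∈ interior s) : HasGradientAt v (affineGradient f) x :=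
  (hasGradientAt_affineMap f x).congr_of_eventuallyEq <|
    hv.eventuallyEq_of_mem (mem_interior_iff_mem_nhds.1 hx)

end AffineGradient

namespace Mesh

variable {E : Type*} [NormedAddCommGroup E] [InnerProductSpace ℝ E]
  {ι : Type*} {d : ℕ} {Ω : Set E}

theorem isCompact_elem (M : Mesh ι d Ω) (T : ι) : IsCompact (M.elem T) :=
  (Set.finite_range (M.cell T)).isCompact_convexHull ℝ

theorem elem_eq_nonneg_coord (M : Mesh ι d Ω) (T : ι) :
    M.elem T = {x | ∀ i, 0 ≤ (M.cell T).coord i x} :=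
  (M.cell T).convexHull_eq_nonneg_coord

theorem interior_elem (M : Mesh ι d Ω) (T : ι) :
    interior (M.elem T) = {x | ∀ i, 0 < (M.cell T).coord i x} :=
  (M.cell T).interior_convexHull

theorem iUnion_elem (M : Mesh ι d Ω) : ⋃ T, M.elem T = closure Ω := M.iUnion_eq

theorem elem_subset_closure (M : Mesh ι d Ω) (T : ι) : M.elem T ⊆ closure Ω :=
  M.iUnion_elem ▸ Set.subset_iUnion M.elem T

theorem exists_mem_elem (M : Mesh ι d Ω) {x : E} (hx : x ∈ Ω) : ∃ T, x ∈ M.elem T :=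
  Set.mem_iUnion.1 (M.iUnion_elem ▸ subset_closure hx)

theorem eq_of_mem_interior_elem (M : Mesh ι d Ω) {S T : ι} {x : E}
    (hS : x ∈ interior (M.elem S)) (hT : x ∈ M.elem T) : S = T := by
  have hx := (M.conforming S T).subset ⟨interior_subset hS, hT⟩
  rw [interior_elem] at hS
  have hsub : Set.range (M.cell S) ⊆ Set.range (M.cell T) := by
    rintro _ ⟨i, rfl⟩
    by_contra hi
    exact (hS i).ne' (coord_eq_zero (M.cell S) Set.inter_subset_left (fun h => hi h.2) hx)
  refine M.cell_injective (Set.eq_of_subset_of_ncard_le hsub ?_ (Set.finite_range _))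
  rw [← Nat.card_coe_set_eq, ← Nat.card_coe_set_eq,
    Nat.card_range_of_injective (M.cell T).ind.injective,
    Nat.card_range_of_injective (M.cell S).ind.injective]

theorem interior_elem_subset (M : Mesh ι d Ω) (T : ι) : interior (M.elem T) ⊆ Ω := by
  intro x hx
  by_contra hxΩ
  have hf : x ∈ frontier Ω := by
    rw [M.isOpen.frontier_eq]
    exact ⟨M.elem_subset_closure T (interior_subset hx), hxΩ⟩
  obtain ⟨S, i, hS, -⟩ := M.boundary x hf
  obtain rfl := M.eq_of_mem_interior_elem hx (convexHull_mono (Set.image_subset_range _ _) hS)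
  rw [interior_elem] at hx
  refine (hx i).ne' (coord_eq_zero (M.cell T) (Set.image_subset_range _ _) ?_ hS)
  rintro ⟨j, hj, hij⟩
  exact hj ((M.cell T).ind.injective hij)

theorem hat_nonneg (M : Mesh ι d Ω) (a x : E) : 0 ≤ M.hat a x := by
  rw [hat]
  split_ifs with h
  · exact (M.elem_eq_nonneg_coord _).subset h.choose_spec.2 _
  · rfl

theorem hat_eq_zero_of_notMem (M : Mesh ι d Ω) {a x : E} (ha : a ∈ M.dof) (hx : x ∉ Ω) :
    M.hat a x = 0 := by
  by_cases hc : x ∈ closure Ω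
  · have hf : x ∈ frontier Ω := by
      rw [M.isOpen.frontier_eq]
      exact ⟨hc, hx⟩
    obtain ⟨S, i, hS, hsub⟩ := M.boundary x hf
    have hxS : x ∈ M.elem S := convexHull_mono (Set.image_subset_range _ _) hS
    by_cases haS : a ∈ Set.range (M.cell S)
    · obtain ⟨k, rfl⟩ := haS
      rw [M.hat_vertex S k hxS]
      refine coord_eq_zero (M.cell S) (Set.image_subset_range _ _) (fun hk => ?_) hS
      exact (M.isOpen.frontier_eq.subset (hsub (subset_convexHull ℝ _ hk))).2 ha.1
    · exact M.hat_of_notMem S haS hxS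
  · rw [hat, dif_neg]
    rintro ⟨p, -, hp⟩
    exact hc (M.elem_subset_closure _ hp)

theorem hat_mem_space (M : Mesh ι d Ω) (a : M.dof) : M.hat a ∈ M.space :=
  Submodule.subset_span ⟨a, a.2, rfl⟩

theorem exists_affineMap_eqOn_elem (M : Mesh ι d Ω) {v : E → ℝ} (hv : v ∈ M.space) (T : ι) :
    ∃ f : E →ᵃ[ℝ] ℝ, Set.EqOn v f (M.elem T) := by
  induction hv using Submodule.span_induction with
  | mem v hv =>
    obtain ⟨a, -, rfl⟩ := hv
    by_cases ha : a ∈ Set.range (M.cell T)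
    · obtain ⟨k, rfl⟩ := ha
      exact ⟨(M.cell T).coord k, fun x hx => M.hat_vertex T k hx⟩
    · exact ⟨0, fun x hx => M.hat_of_notMem T ha hx⟩
  | zero => exact ⟨0, fun _ _ => rfl⟩
  | add v w _ _ hv hw =>
    obtain ⟨f, hf⟩ := hv
    obtain ⟨g, hg⟩ := hw
    exact ⟨f + g, fun x hx => congrArg₂ (· + ·) (hf hx) (hg hx)⟩
  | smul r v _ hv =>
    obtain ⟨f, hf⟩ := hv
    exact ⟨r • f, fun x hx => congrArg (r • ·) (hf hx)⟩

theorem eq_zero_of_notMem (M : Mesh ι d Ω) {v : E → ℝ} (hv : v ∈ M.space) {x : E} (hx : x ∉ Ω) :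
    v x = 0 := by
  induction hv using Submodule.span_induction with
  | mem v hv =>
    obtain ⟨a, ha, rfl⟩ := hv
    exact M.hat_eq_zero_of_notMem ha hx
  | zero => rfl
  | add v w _ _ hv hw => simp only [Pi.add_apply, hv, hw, add_zero]
  | smul r v _ hv => simp only [Pi.smul_apply, hv, smul_zero]

section NodalValues

variable [Finite ι]

/-- The finite element function with the given nodal values. -/
noncomputable def interp (M : Mesh ι d Ω) : (M.dof → ℝ) →ₗ[ℝ] (E → ℝ) :=
  Fintype.linearCombination ℝ fun a : M.dof => M.hat a

theorem interp_eq_sum (M : Mesh ι d Ω) (w : M.dof → ℝ) :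
    M.interp w = ∑ a : M.dof, w a • M.hat a :=
  Fintype.linearCombination_apply _ _ _

theorem range_interp (M : Mesh ι d Ω) : LinearMap.range M.interp = M.space := by
  rw [interp, Fintype.range_linearCombination, space, Set.image_eq_range]

theorem interp_mem_space (M : Mesh ι d Ω) (w : M.dof → ℝ) : M.interp w ∈ M.space :=
  M.range_interp ▸ LinearMap.mem_range_self _ w

theorem exists_interp_eq (M : Mesh ι d Ω) {v : E → ℝ} (hv : v ∈ M.space) :
    ∃ w, M.interp w = v :=
  LinearMap.mem_range.1 (M.range_interp ▸ hv)

theorem interp_apply_dof (M : Mesh ι d Ω) (w : M.dof → ℝ) (a : M.dof) : M.interp w a = w a := by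
  obtain ⟨T, k, hk⟩ := a.2.2
  have hT : M.cell T k ∈ M.elem T := subset_convexHull ℝ _ (Set.mem_range_self k)
  rw [interp_eq_sum, Finset.sum_apply, Finset.sum_eq_single a _ (by simp), ← hk]
  · rw [Pi.smul_apply, M.hat_vertex T k hT, AffineBasis.coord_apply_eq, smul_eq_mul, mul_one]
  · intro c _ hca
    rw [← hk, Pi.smul_apply]
    by_cases hc : (c : E) ∈ Set.range (M.cell T)
    · obtain ⟨l, hl⟩ := hc
      have hlk : l ≠ k := fun h => hca (Subtype.ext (hl.symm.trans (h ▸ hk)))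
      rw [← hl, M.hat_vertex T l hT, AffineBasis.coord_apply_ne _ hlk, smul_zero]
    · rw [M.hat_of_notMem T hc hT, smul_zero]

theorem interp_nonneg (M : Mesh ι d Ω) {w : M.dof → ℝ} (hw : 0 ≤ w) : 0 ≤ M.interp w := by
  rw [interp_eq_sum]
  exact Finset.sum_nonneg fun a _ => smul_nonneg (hw a) fun x => M.hat_nonneg a x

end NodalValues

section FiniteDimensional

variable [FiniteDimensional ℝ E]

theorem continuous_of_mem_space [Finite ι] (M : Mesh ι d Ω) {v : E → ℝ}
    (hv : v ∈ M.space) : Continuous v := by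
  let cover : Option ι → Set E := fun o => o.elim Ωᶜ M.elem
  refine (locallyFinite_of_finite cover).continuous ?_ ?_ ?_
  · refine Set.eq_univ_of_forall fun x => Set.mem_iUnion.2 ?_
    by_cases hx : x ∈ Ω
    · exact (M.exists_mem_elem hx).imp' some fun _ => id
    · exact ⟨none, hx⟩
  · rintro (_ | T)
    · exact M.isOpen.isClosed_compl
    · exact (M.isCompact_elem T).isClosed
  · rintro (_ | T)
    · exact (continuousOn_const (c := (0 : ℝ))).congr fun x hx => M.eq_zero_of_notMem hv hx
    · obtain ⟨f, hf⟩ := M.exists_affineMap_eqOn_elem hv T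
      exact f.continuous_of_finiteDimensional.continuousOn.congr hf

theorem eq_zero_of_forall_elem_const [Finite ι] [NoncompactSpace E] (M : Mesh ι d Ω)
    {v : E → ℝ} (hv : v ∈ M.space) (hconst : ∀ T, ∃ c, ∀ x ∈ M.elem T, v x = c) : v = 0 := by
  choose c hc using hconst
  have hfin : (Set.range v).Finite := by
    refine ((Set.finite_range c).insert 0).subset ?_
    rintro _ ⟨x, rfl⟩
    by_cases hx : x ∈ Ω
    · obtain ⟨T, hT⟩ := M.exists_mem_elem hx
      exact Or.inr ⟨T, (hc T x hT).symm⟩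
    · exact Or.inl (M.eq_zero_of_notMem hv hx)
  have hsub : (Set.range v).Subsingleton :=
    hfin.countable.isTotallyDisconnected _ le_rfl
      (isPreconnected_range (M.continuous_of_mem_space hv))
  have hcompact : IsCompact (closure Ω) := M.iUnion_elem ▸ isCompact_iUnion M.isCompact_elem
  obtain ⟨x₀, hx₀⟩ := (Set.ne_univ_iff_exists_notMem _).1 hcompact.ne_univ
  ext x
  rw [hsub ⟨x, rfl⟩ ⟨x₀, rfl⟩, M.eq_zero_of_notMem hv fun h => hx₀ (subset_closure h),
    Pi.zero_apply]

section Measure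

variable [MeasureSpace E] [BorelSpace E] [(volume : Measure E).IsAddHaarMeasure]

theorem interior_elem_ae_eq (M : Mesh ι d Ω) (T : ι) :
    (interior (M.elem T) : Set E) =ᵐ[volume] M.elem T :=
  interior_ae_eq_of_null_frontier ((convex_convexHull ℝ _).addHaar_frontier volume)

theorem ae_mem_interior_elem (M : Mesh ι d Ω) (T : ι) :
    ∀ᵐ x ∂volume.restrict (M.elem T), x ∈ interior (M.elem T) := by
  rw [← Measure.restrict_congr_set (M.interior_elem_ae_eq T)]
  exact ae_restrict_mem isOpen_interior.measurableSet

theorem restrict_elem_le (M : Mesh ι d Ω) (T : ι) :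
    volume.restrict (M.elem T) ≤ volume.restrict Ω := by
  rw [← Measure.restrict_congr_set (M.interior_elem_ae_eq T)]
  exact Measure.restrict_mono_set _ (M.interior_elem_subset T)

theorem iUnion_interior_elem_ae_eq [Finite ι] (M : Mesh ι d Ω) :
    (⋃ T, interior (M.elem T) : Set E) =ᵐ[volume] Ω := by
  have hunion : (⋃ T, interior (M.elem T) : Set E) =ᵐ[volume] ⋃ T, M.elem T :=
    Filter.EventuallyEq.countable_iUnion fun T => M.interior_elem_ae_eq T
  have hsub : Ω ⊆ ⋃ T, M.elem T := fun x hx => Set.mem_iUnion.2 (M.exists_mem_elem hx)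
  exact (Set.iUnion_subset M.interior_elem_subset).eventuallyLE.antisymm
    (hsub.eventuallyLE.trans hunion.symm.le)

theorem restrict_eq_sum [Fintype ι] (M : Mesh ι d Ω) :
    volume.restrict Ω = ∑ T, volume.restrict (M.elem T) := by
  rw [← Measure.restrict_congr_set M.iUnion_interior_elem_ae_eq, Measure.restrict_iUnion,
    Measure.sum_fintype]
  · exact Finset.sum_congr rfl fun T _ => Measure.restrict_congr_set (M.interior_elem_ae_eq T)
  · exact fun S T hST => Set.disjoint_left.2 fun x hS hT =>
      hST (M.eq_of_mem_interior_elem hS (interior_subset hT))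
  · exact fun T => isOpen_interior.measurableSet

theorem ae_exists_mem_interior_elem [Finite ι] (M : Mesh ι d Ω) :
    ∀ᵐ x ∂volume.restrict Ω, ∃ T, x ∈ interior (M.elem T) := by
  cases nonempty_fintype ι
  rw [M.restrict_eq_sum, ← Measure.sum_fintype, Measure.ae_sum_iff]
  exact fun T => (M.ae_mem_interior_elem T).mono fun x hx => ⟨T, hx⟩

theorem integrableOn_iff_forall_elem [Finite ι] (M : Mesh ι d Ω) {f : E → ℝ} :
    IntegrableOn f Ω ↔ ∀ T, IntegrableOn f (M.elem T) := by
  cases nonempty_fintype ι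
  simp only [IntegrableOn, M.restrict_eq_sum, integrable_finsetSum_measure, Finset.mem_univ,
    true_implies]

theorem setIntegral_eq_sum [Fintype ι] (M : Mesh ι d Ω) {f : E → ℝ} (hf : IntegrableOn f Ω) :
    ∫ x in Ω, f x = ∑ T, ∫ x in M.elem T, f x := by
  rw [M.restrict_eq_sum,
    integral_finsetSum_measure fun T _ => M.integrableOn_iff_forall_elem.1 hf T]

end Measure

theorem eq_zero_of_ae_gradient_eq_zero [Finite ι] [NoncompactSpace E] [MeasureSpace E]
    [OpensMeasurableSpace E] [(volume : Measure E).IsOpenPosMeasure] (M : Mesh ι d Ω) {v : E → ℝ}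
    (hv : v ∈ M.space) (hgrad : ∀ᵐ x ∂volume.restrict Ω, gradient v x = 0) : v = 0 := by
  refine M.eq_zero_of_forall_elem_const hv fun T => ?_
  obtain ⟨f, hf⟩ := M.exists_affineMap_eqOn_elem hv T
  have hgradT : ∀ᵐ x ∂volume.restrict (interior (M.elem T)), gradient v x = 0 :=
    ae_mono (Measure.restrict_mono_set volume (M.interior_elem_subset T)) hgrad
  have : (ae (volume.restrict (interior (M.elem T)))).NeBot := by
    rw [ae_neBot, Ne, Measure.restrict_eq_zero]
    exact (isOpen_interior.measure_pos volume
      ⟨_, (M.cell T).centroid_mem_interior_convexHull⟩).ne'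
  obtain ⟨x, hgx, hx⟩ :=
    (hgradT.and (ae_restrict_mem isOpen_interior.measurableSet)).exists
  have hlinear : affineGradient f = 0 :=
    (hasGradientAt_of_eqOn_affineMap hf hx).gradient.symm.trans hgx
  refine ⟨f x, fun y hy => ?_⟩
  rw [hf hy, ← sub_eq_zero, ← vsub_eq_sub (f y), ← f.linearMap_vsub, ← inner_affineGradient,
    hlinear, inner_zero_left]

section ReactionDiffusion

/-- The integrand `∇f · ∇g + c f g` of the weak form of the linear reaction–diffusion operator
`-Δ + c`. -/
noncomputable def energyIntegrand (c f g : E → ℝ) (x : E) : ℝ :=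
  inner ℝ (gradient f x) (gradient g x) + c x * (f x * g x)

theorem energyIntegrand_comm (c f g : E → ℝ) : energyIntegrand c f g = energyIntegrand c g f := by
  ext x
  rw [energyIntegrand, energyIntegrand, real_inner_comm, mul_comm (f x)]

variable [MeasureSpace E] {M : Mesh ι d Ω} {c : E → ℝ} {B : ℝ}

/-- The Galerkin matrix of the reaction–diffusion operator `-Δ + c` in the nodal basis. -/
noncomputable def galerkinMatrix (M : Mesh ι d Ω) (c : E → ℝ) : Matrix M.dof M.dof ℝ :=
  Matrix.of fun i j => ∫ x in Ω, energyIntegrand c (M.hat i) (M.hat j) x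

theorem isSymm_galerkinMatrix : (M.galerkinMatrix c).IsSymm :=
  Matrix.IsSymm.ext fun i j => by
    rw [galerkinMatrix, Matrix.of_apply, Matrix.of_apply, energyIntegrand_comm]

variable [BorelSpace E] [(volume : Measure E).IsAddHaarMeasure]

theorem integrableOn_inner_gradient {f g : E → ℝ} (hf : f ∈ M.space) (hg : g ∈ M.space) (T : ι) :
    IntegrableOn (fun x => inner ℝ (gradient f x) (gradient g x)) (M.elem T) := by
  obtain ⟨F, hF⟩ := M.exists_affineMap_eqOn_elem hf T
  obtain ⟨G, hG⟩ := M.exists_affineMap_eqOn_elem hg T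
  refine (integrableOn_const (C := inner ℝ (affineGradient F) (affineGradient G))
    (M.isCompact_elem T).measure_lt_top.ne).congr ?_
  filter_upwards [M.ae_mem_interior_elem T] with x hx
  rw [(hasGradientAt_of_eqOn_affineMap hF hx).gradient,
    (hasGradientAt_of_eqOn_affineMap hG hx).gradient]

theorem integrableOn_coeff_mul (hc : IsReactionCoefficient Ω c B) {f : E → ℝ}
    (hf : Continuous f) (T : ι) :
    IntegrableOn (fun x => c x * f x) (M.elem T) := by
  refine (hf.continuousOn.integrableOn_compact (M.isCompact_elem T)).bdd_mul (c := B)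
    (hc.aestronglyMeasurable.mono_measure (M.restrict_elem_le T)) ?_
  filter_upwards [ae_mono (M.restrict_elem_le T) hc.ae_mem_Icc] with x hx
  rw [Real.norm_of_nonneg hx.1]
  exact hx.2

theorem setIntegral_energyIntegrand_hat_of_notMem (T : ι) {a : E} (g : E → ℝ)
    (ha : a ∉ Set.range (M.cell T)) : ∫ x in M.elem T, energyIntegrand c (M.hat a) g x = 0 := by
  refine integral_eq_zero_of_ae ?_
  filter_upwards [M.ae_mem_interior_elem T] with x hx
  have hzero : Set.EqOn (M.hat a) (0 : E →ᵃ[ℝ] ℝ) (M.elem T) := fun y hy =>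
    M.hat_of_notMem T ha hy
  rw [energyIntegrand, (hasGradientAt_of_eqOn_affineMap hzero hx).gradient,
    hzero (interior_subset hx), map_zero, inner_zero_left, AffineMap.coe_zero, Pi.zero_apply,
    zero_mul, mul_zero, add_zero]

theorem ae_energyIntegrand_hat_vertex (T : ι) (k l : Fin (d + 1)) :
    ∀ᵐ x ∂volume.restrict (M.elem T),
      energyIntegrand c (M.hat (M.cell T k)) (M.hat (M.cell T l)) x =
        inner ℝ (affineGradient ((M.cell T).coord k)) (affineGradient ((M.cell T).coord l)) +
          c x * ((M.cell T).coord k x * (M.cell T).coord l x) := by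
  filter_upwards [M.ae_mem_interior_elem T] with x hx
  have hat_eqOn : ∀ i, Set.EqOn (M.hat (M.cell T i)) ((M.cell T).coord i) (M.elem T) :=
    fun i y hy => M.hat_vertex T i hy
  rw [energyIntegrand, (hasGradientAt_of_eqOn_affineMap (hat_eqOn k) hx).gradient,
    (hasGradientAt_of_eqOn_affineMap (hat_eqOn l) hx).gradient,
    hat_eqOn k (interior_subset hx), hat_eqOn l (interior_subset hx)]

theorem setIntegral_energyIntegrand_hat_vertex_le (hc : IsReactionCoefficient Ω c B) (T : ι)
    {k l : Fin (d + 1)} (hkl : k ≠ l) :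
    ∫ x in M.elem T, energyIntegrand c (M.hat (M.cell T k)) (M.hat (M.cell T l)) x ≤
      volume.real (M.elem T) *
        (inner ℝ (affineGradient ((M.cell T).coord k)) (affineGradient ((M.cell T).coord l)) +
          B / ((d + 1) * (d + 2))) := by
  set s := inner ℝ (affineGradient ((M.cell T).coord k)) (affineGradient ((M.cell T).coord l))
    with hs
  have hcont : Continuous fun x => (M.cell T).coord k x * (M.cell T).coord l x :=
    ((M.cell T).coord k).continuous_of_finiteDimensional.mul
      ((M.cell T).coord l).continuous_of_finiteDimensional
  have hconst : Integrable (fun _ => s) (volume.restrict (M.elem T)) :=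
    integrableOn_const (M.isCompact_elem T).measure_lt_top.ne
  have hmass : IntegrableOn (fun x => (M.cell T).coord k x * (M.cell T).coord l x) (M.elem T) :=
    hcont.continuousOn.integrableOn_compact (M.isCompact_elem T)
  rw [integral_congr_ae (ae_energyIntegrand_hat_vertex T k l), ← hs]
  calc ∫ x in M.elem T, (s + c x * ((M.cell T).coord k x * (M.cell T).coord l x))
      ≤ ∫ x in M.elem T, (s + B * ((M.cell T).coord k x * (M.cell T).coord l x)) := by
        refine integral_mono_ae (hconst.add (integrableOn_coeff_mul hc hcont T))
          (hconst.add (hmass.const_mul B)) ?_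
        filter_upwards [ae_mono (M.restrict_elem_le T) hc.ae_mem_Icc,
          ae_restrict_mem (M.isCompact_elem T).measurableSet] with x hx hxT
        rw [elem_eq_nonneg_coord] at hxT
        exact add_le_add_right (mul_le_mul_of_nonneg_right hx.2 (mul_nonneg (hxT k) (hxT l))) s
    _ = volume.real (M.elem T) * (s + B / ((d + 1) * (d + 2))) := by
        rw [integral_add hconst (hmass.const_mul B), setIntegral_const,
          integral_const_mul, elem, setIntegral_coord_mul_coord volume (M.cell T) hkl]
        simp only [Fintype.card_fin, smul_eq_mul, Nat.cast_add, Nat.cast_one]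
        ring

variable [Finite ι]

theorem integrableOn_energyIntegrand (hc : IsReactionCoefficient Ω c B) {f g : E → ℝ}
    (hf : f ∈ M.space) (hg : g ∈ M.space) : IntegrableOn (energyIntegrand c f g) Ω :=
  M.integrableOn_iff_forall_elem.2 fun T => (integrableOn_inner_gradient hf hg T).add
    (integrableOn_coeff_mul hc
      ((M.continuous_of_mem_space hf).mul (M.continuous_of_mem_space hg)) T)

theorem ae_gradient_interp (w : M.dof → ℝ) : ∀ᵐ x ∂volume.restrict Ω,
    gradient (M.interp w) x = ∑ a, w a • gradient (M.hat a) x := by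
  filter_upwards [M.ae_exists_mem_interior_elem] with x ⟨T, hx⟩
  choose F hF using fun a : M.dof => M.exists_affineMap_eqOn_elem (M.hat_mem_space a) T
  have hinterp : Set.EqOn (M.interp w) (∑ a, w a • F a : E →ᵃ[ℝ] ℝ) (M.elem T) := by
    intro y hy
    have hcoe : ∀ s : Finset M.dof, (∑ a ∈ s, w a • F a : E →ᵃ[ℝ] ℝ) y = ∑ a ∈ s, w a * F a y := by
      intro s
      induction s using Finset.cons_induction with
      | empty => rfl
      | cons a s ha ih => simp [Finset.sum_cons, ih]
    rw [interp_eq_sum, Finset.sum_apply, hcoe]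
    exact Finset.sum_congr rfl fun a _ => congrArg (w a * ·) (hF a hy)
  rw [(hasGradientAt_of_eqOn_affineMap hinterp hx).gradient, map_sum]
  exact Finset.sum_congr rfl fun a _ => by
    rw [map_smul, (hasGradientAt_of_eqOn_affineMap (hF a) hx).gradient]

theorem setIntegral_energyIntegrand_interp (hc : IsReactionCoefficient Ω c B) {f : E → ℝ}
    (hf : f ∈ M.space) (w : M.dof → ℝ) :
    ∫ x in Ω, energyIntegrand c f (M.interp w) x =
      ∑ a, w a * ∫ x in Ω, energyIntegrand c f (M.hat a) x := by
  have hexpand : ∀ᵐ x ∂volume.restrict Ω, energyIntegrand c f (M.interp w) x =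
      ∑ a, w a * energyIntegrand c f (M.hat a) x := by
    filter_upwards [ae_gradient_interp w] with x hx
    rw [energyIntegrand, hx, inner_sum, interp_eq_sum, Finset.sum_apply, Finset.mul_sum,
      Finset.mul_sum, ← Finset.sum_add_distrib]
    refine Finset.sum_congr rfl fun a _ => ?_
    rw [energyIntegrand, real_inner_smul_right, Pi.smul_apply, smul_eq_mul]
    ring
  rw [integral_congr_ae hexpand, integral_finsetSum _ fun a _ =>
    (integrableOn_energyIntegrand hc hf (M.hat_mem_space a)).const_mul (w a)]
  exact Finset.sum_congr rfl fun a _ => integral_const_mul _ _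

open Matrix in
theorem galerkinMatrix_mulVec (hc : IsReactionCoefficient Ω c B) (w : M.dof → ℝ) (a : M.dof) :
    (M.galerkinMatrix c *ᵥ w) a = ∫ x in Ω, energyIntegrand c (M.hat a) (M.interp w) x := by
  rw [setIntegral_energyIntegrand_interp hc (M.hat_mem_space a)]
  exact Finset.sum_congr rfl fun _ _ => mul_comm _ _

open Matrix in
theorem dotProduct_galerkinMatrix_mulVec (hc : IsReactionCoefficient Ω c B) (w : M.dof → ℝ) :
    w ⬝ᵥ M.galerkinMatrix c *ᵥ w = ∫ x in Ω, energyIntegrand c (M.interp w) (M.interp w) x := by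
  rw [setIntegral_energyIntegrand_interp hc (M.interp_mem_space w)]
  refine Finset.sum_congr rfl fun a _ => ?_
  rw [galerkinMatrix_mulVec hc, energyIntegrand_comm]

theorem posDef_galerkinMatrix [NoncompactSpace E]
    (hc : IsReactionCoefficient Ω c B) : (M.galerkinMatrix c).PosDef := by
  refine Matrix.PosDef.of_dotProduct_mulVec_pos
    ((Matrix.conjTranspose_eq_transpose_of_trivial _).trans isSymm_galerkinMatrix) fun w hw => ?_
  rw [star_trivial, dotProduct_galerkinMatrix_mulVec hc]
  set v := M.interp w
  have hv : v ∈ M.space := M.interp_mem_space w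
  have henergy : ∀ᵐ x ∂volume.restrict Ω, ‖gradient v x‖ ^ 2 ≤ energyIntegrand c v v x := by
    filter_upwards [hc.ae_mem_Icc] with x hx
    rw [energyIntegrand, real_inner_self_eq_norm_sq]
    exact le_add_of_nonneg_right (mul_nonneg hx.1 (mul_self_nonneg _))
  have hnonneg : 0 ≤ᵐ[volume.restrict Ω] energyIntegrand c v v :=
    henergy.mono fun x hx => (sq_nonneg _).trans hx
  refine (integral_nonneg_of_ae hnonneg).lt_of_ne fun hzero => hw ?_
  have hgrad : ∀ᵐ x ∂volume.restrict Ω, gradient v x = 0 := by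
    filter_upwards [henergy, (integral_eq_zero_iff_of_nonneg_ae hnonneg
      (integrableOn_energyIntegrand hc hv hv)).1 hzero.symm] with x hx hx0
    exact norm_eq_zero.1 (pow_eq_zero_iff two_ne_zero |>.1 ((hx.trans_eq hx0).antisymm
      (sq_nonneg _)))
  ext a
  exact (M.interp_apply_dof w a).symm.trans
    (congrFun (M.eq_zero_of_ae_gradient_eq_zero hv hgrad) a)

theorem galerkinMatrix_nonpos_of_ne (hc : IsReactionCoefficient Ω c B)
    (hM : ∀ T k l, k ≠ l →
      inner ℝ (affineGradient ((M.cell T).coord k)) (affineGradient ((M.cell T).coord l)) ≤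
        -(B / ((d + 1) * (d + 2))))
    {i j : M.dof} (hij : i ≠ j) : M.galerkinMatrix c i j ≤ 0 := by
  cases nonempty_fintype ι
  rw [galerkinMatrix, Matrix.of_apply, M.setIntegral_eq_sum
    (integrableOn_energyIntegrand hc (M.hat_mem_space i) (M.hat_mem_space j))]
  refine Finset.sum_nonpos fun T _ => ?_
  by_cases hi : (i : E) ∈ Set.range (M.cell T)
  · by_cases hj : (j : E) ∈ Set.range (M.cell T)
    · obtain ⟨k, hk⟩ := hi
      obtain ⟨l, hl⟩ := hj
      have hkl : k ≠ l := fun h => hij (Subtype.ext (hk.symm.trans (h ▸ hl)))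
      rw [← hk, ← hl]
      refine (setIntegral_energyIntegrand_hat_vertex_le hc T hkl).trans ?_
      exact mul_nonpos_of_nonneg_of_nonpos measureReal_nonneg
        (by linarith only [hM T k l hkl])
    · rw [energyIntegrand_comm, setIntegral_energyIntegrand_hat_of_notMem T _ hj]
  · rw [setIntegral_energyIntegrand_hat_of_notMem T _ hi]

theorem isStieltjes_galerkinMatrix [NoncompactSpace E] (hc : IsReactionCoefficient Ω c B)
    (hM : ∀ T k l, k ≠ l →
      inner ℝ (affineGradient ((M.cell T).coord k)) (affineGradient ((M.cell T).coord l)) ≤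
        -(B / ((d + 1) * (d + 2)))) : IsStieltjes (M.galerkinMatrix c) :=
  ⟨isSymm_galerkinMatrix, posDef_galerkinMatrix hc, fun _ _ => galerkinMatrix_nonpos_of_ne hc hM⟩

end ReactionDiffusion

section Comparison

variable [MeasureSpace E] [BorelSpace E] [(volume : Measure E).IsAddHaarMeasure]
  {M : Mesh ι d Ω} {b : E → ℝ → ℝ} {B : ℝ} {u₁ u₂ : E → ℝ}

theorem ae_energyIntegrand_dslope_interp_sub [Finite ι] (b : E → ℝ → ℝ) (v : E → ℝ)
    (w₁ w₂ : M.dof → ℝ) :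
    ∀ᵐ x ∂volume.restrict Ω,
      energyIntegrand (fun x => dslope (b x) (M.interp w₂ x) (M.interp w₁ x)) v
        (M.interp (w₂ - w₁)) x =
      weakIntegrand b (M.interp w₂) v x - weakIntegrand b (M.interp w₁) v x := by
  filter_upwards [ae_gradient_interp w₁, ae_gradient_interp w₂, ae_gradient_interp (w₂ - w₁)]
    with x hx₁ hx₂ hx
  have hgrad : gradient (M.interp (w₂ - w₁)) x =
      gradient (M.interp w₂) x - gradient (M.interp w₁) x := by
    simp only [hx₁, hx₂, hx, Pi.sub_apply, sub_smul, Finset.sum_sub_distrib]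
  have hslope := sub_smul_dslope (b x) (M.interp w₂ x) (M.interp w₁ x)
  rw [smul_eq_mul] at hslope
  rw [energyIntegrand, weakIntegrand, weakIntegrand, hgrad, inner_sub_right, map_sub,
    Pi.sub_apply, real_inner_comm, real_inner_comm (gradient (M.interp w₁) x)]
  linear_combination (-v x) * hslope

variable [Fintype ι]

theorem systemMatrix_eq_galerkinMatrix (hb : LowerOrderTerm Ω b B) (h₁ : u₁ ∈ M.space)
    (h₂ : u₂ ∈ M.space) :
    M.systemMatrix b u₁ u₂ = M.galerkinMatrix fun x => dslope (b x) (u₂ x) (u₁ x) := by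
  have hc := hb.isReactionCoefficient_dslope (M.continuous_of_mem_space h₁).measurable
    (M.continuous_of_mem_space h₂).measurable
  ext i j
  have hi := M.hat_mem_space i
  have hj := M.hat_mem_space j
  simp only [systemMatrix, stiffness, mass, galerkinMatrix, Matrix.add_apply, Matrix.of_apply]
  rw [M.setIntegral_eq_sum (integrableOn_energyIntegrand hc hi hj), ← Finset.sum_add_distrib]
  refine Finset.sum_congr rfl fun T _ => ?_
  have hmass : ∫ x in M.elem T, ∫ t in (0 : ℝ)..1,
      deriv (b x) (t * u₁ x + (1 - t) * u₂ x) * M.hat i x * M.hat j x =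
      ∫ x in M.elem T, dslope (b x) (u₂ x) (u₁ x) * (M.hat i x * M.hat j x) := by
    refine integral_congr_ae ?_
    filter_upwards [ae_mono (M.restrict_elem_le T) hb.contDiff] with x hx
    rw [intervalIntegral.integral_mul_const, intervalIntegral.integral_mul_const,
      integral_deriv_segment_eq_dslope hx, mul_assoc]
  rw [hmass]
  exact (integral_add (integrableOn_inner_gradient hi hj T) (integrableOn_coeff_mul hc
    ((M.continuous_of_mem_space hi).mul (M.continuous_of_mem_space hj)) T)).symm

open Matrix in
theorem subsolution_le_supersolution (hb : LowerOrderTerm Ω b B) (h₁ : M.IsSubsolution b u₁)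
    (h₂ : M.IsSupersolution b u₂) (hA : IsStieltjes (M.systemMatrix b u₁ u₂)) : u₁ ≤ u₂ := by
  have hc := hb.isReactionCoefficient_dslope (M.continuous_of_mem_space h₁.1).measurable
    (M.continuous_of_mem_space h₂.1).measurable
  rw [systemMatrix_eq_galerkinMatrix hb h₁.1 h₂.1] at hA
  obtain ⟨w₁, rfl⟩ := M.exists_interp_eq h₁.1
  obtain ⟨w₂, rfl⟩ := M.exists_interp_eq h₂.1
  rw [← sub_nonneg, ← map_sub]
  refine M.interp_nonneg (hA.nonneg_of_mulVec_nonneg fun a => ?_)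
  obtain ⟨hint₁, hle₁⟩ := h₁.2 (M.hat a) (M.hat_mem_space a) fun x _ => M.hat_nonneg a x
  obtain ⟨hint₂, hle₂⟩ := h₂.2 (M.hat a) (M.hat_mem_space a) fun x _ => M.hat_nonneg a x
  rw [Pi.zero_apply, galerkinMatrix_mulVec hc,
    integral_congr_ae (ae_energyIntegrand_dslope_interp_sub b (M.hat a) w₁ w₂),
    integral_sub hint₂ hint₁]
  exact sub_nonneg.2 (hle₁.trans hle₂)

end Comparison

end FiniteDimensional

end Mesh

theorem theorem5p2_general {E : Type*} [NormedAddCommGroup E] [InnerProductSpace ℝ E]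
    [FiniteDimensional ℝ E] [Nontrivial E] [MeasureSpace E] [BorelSpace E]
    [(volume : Measure E).IsAddHaarMeasure] {ι : Type*} [Fintype ι] {d : ℕ} {Ω : Set E}
    (M : Mesh ι d Ω) [DecidableEq M.dof] {b : E → ℝ → ℝ} {Bη : ℝ} {u₁ u₂ : E → ℝ}
    (hb : LowerOrderTerm Ω b Bη) (h₁ : M.IsSubsolution b u₁) (h₂ : M.IsSupersolution b u₂)
    (hM : ∀ T k l, k ≠ l →
      inner ℝ (affineGradient ((M.cell T).coord k)) (affineGradient ((M.cell T).coord l)) ≤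
        -(Bη / ((d + 1) * (d + 2)))) :
    IsStieltjes (M.systemMatrix b u₁ u₂) ∧
    (∀ i j, 0 ≤ (M.systemMatrix b u₁ u₂)⁻¹ i j) ∧
    ∀ x ∈ Ω, u₁ x ≤ u₂ x := by
  have : NoncompactSpace E := RealNormedSpace.noncompactSpace E
  have hA : IsStieltjes (M.systemMatrix b u₁ u₂) := by
    rw [Mesh.systemMatrix_eq_galerkinMatrix hb h₁.1 h₂.1]
    exact Mesh.isStieltjes_galerkinMatrix (hb.isReactionCoefficient_dslope
      (M.continuous_of_mem_space h₁.1).measurable (M.continuous_of_mem_space h₂.1).measurable) hM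
  exact ⟨hA, hA.inv_nonneg, fun x _ => Mesh.subsolution_le_supersolution hb h₁ h₂ hA x⟩

section Interval

theorem inner_affineGradient_coord_of_ne (B : AffineBasis (Fin 2) ℝ ℝ) {k l : Fin 2} (hkl : k ≠ l) :
    inner ℝ (affineGradient (B.coord k)) (affineGradient (B.coord l)) =
      -((B 1 - B 0) ^ 2)⁻¹ := by
  have hlen : B 1 - B 0 ≠ 0 := sub_ne_zero.2 (B.ind.injective.ne one_ne_zero)
  have h₀ : affineGradient (B.coord 0) = -(B 1 - B 0)⁻¹ := by
    have h := inner_affineGradient (B.coord 0) (B 1 - B 0)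
    rw [linear_coord_sub] at h
    norm_num at h
    field_simp
    linarith
  have h₁ : affineGradient (B.coord 1) = (B 1 - B 0)⁻¹ := by
    have h := inner_affineGradient (B.coord 1) (B 1 - B 0)
    rw [linear_coord_sub] at h
    norm_num at h
    exact eq_inv_of_mul_eq_one_right h
  obtain ⟨rfl, rfl⟩ | ⟨rfl, rfl⟩ : k = 0 ∧ l = 1 ∨ k = 1 ∧ l = 0 := by
    decide +revert
  all_goals
    rw [h₀, h₁]
    simp [sq]

theorem inner_affineGradient_coord_le_of_length (B : AffineBasis (Fin 2) ℝ ℝ) {β : ℝ}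
    (hβ : β * (B 1 - B 0) ^ 2 ≤ 6) {k l : Fin 2} (hkl : k ≠ l) :
    inner ℝ (affineGradient (B.coord k)) (affineGradient (B.coord l)) ≤ -(β / 6) := by
  have hlen : 0 < (B 1 - B 0) ^ 2 :=
    sq_pos_of_ne_zero (sub_ne_zero.2 (B.ind.injective.ne one_ne_zero))
  rw [inner_affineGradient_coord_of_ne B hkl, neg_le_neg_iff, div_le_iff₀ (by norm_num),
    inv_mul_eq_div, le_div_iff₀ hlen]
  exact hβ

end Interval

theorem measureReal_simplex_pos {E : Type*} [NormedAddCommGroup E] [NormedSpace ℝ E]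
    [MeasurableSpace E] (μ : Measure E) [μ.IsAddHaarMeasure] {κ : Type*} [Finite κ]
    (B : AffineBasis κ ℝ E) : 0 < μ.real (convexHull ℝ (Set.range B)) := by
  cases nonempty_fintype κ
  exact ENNReal.toReal_pos
    (Measure.measure_pos_of_nonempty_interior μ ⟨_, B.centroid_mem_interior_convexHull⟩).ne'
    ((Set.finite_range B).isCompact_convexHull ℝ).measure_lt_top.ne

section Triangle

section Coordinates

variable {V : Type*} [AddCommGroup V] [Module ℝ V] (T : AffineBasis (Fin 3) ℝ V) (k : Fin 3)

theorem coord_add_coord_add_coord (x : V) :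
    T.coord k x + T.coord (k + 1) x + T.coord (k + 2) x = 1 := by
  rw [← T.sum_coord_apply_eq_one x, Fin.sum_univ_three]
  fin_cases k <;> simp <;> ring

theorem sub_vertex_eq_coord_smul_add (x : V) :
    x - T k = T.coord (k + 1) x • (T (k + 1) - T k) + T.coord (k + 2) x • (T (k + 2) - T k) := by
  have hx : T.coord k x • T k + T.coord (k + 1) x • T (k + 1) + T.coord (k + 2) x • T (k + 2) =
      x := by
    conv_rhs => rw [← T.linear_combination_coord_eq_self x, Fin.sum_univ_three]
    fin_cases k <;> simp <;> abel
  have hk : T.coord k x = 1 - T.coord (k + 1) x - T.coord (k + 2) x := by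
    linarith [coord_add_coord_add_coord T k x]
  rw [hk] at hx
  conv_lhs => rw [← hx]
  module

theorem eq_linear_coord_smul_add (v : V) :
    v = (T.coord (k + 1)).linear v • (T (k + 1) - T k) +
      (T.coord (k + 2)).linear v • (T (k + 2) - T k) := by
  have hk : k + 1 ≠ k ∧ k + 2 ≠ k := by fin_cases k <;> decide
  have h := sub_vertex_eq_coord_smul_add T k (v +ᵥ T k)
  rw [AffineMap.map_vadd, AffineMap.map_vadd, T.coord_apply_ne hk.1, T.coord_apply_ne hk.2] at h
  simpa using h

/-- The closed parallelogram spanned by the edges of the triangle `T` at its vertex `k`, in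
barycentric coordinates.  The third edge of `T` is a diagonal of it. -/
def parallelogram : Set V :=
  {x | T.coord (k + 1) x ∈ Set.Icc 0 1 ∧ T.coord (k + 2) x ∈ Set.Icc 0 1}

theorem preimage_sub_vertex_parallelepiped :
    (fun x => x - T k) ⁻¹' parallelepiped ![T (k + 1) - T k, T (k + 2) - T k] =
      parallelogram T k := by
  ext x
  simp only [Set.mem_preimage, mem_parallelepiped_iff, Fin.sum_univ_two, Matrix.cons_val_zero,
    Matrix.cons_val_one, parallelogram, Set.mem_ofPred_eq]
  constructor
  · rintro ⟨t, ht, hx⟩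
    have hcoord : ∀ i, T.coord i x = t 0 * (T.coord i).linear (T (k + 1) - T k) +
        t 1 * (T.coord i).linear (T (k + 2) - T k) + T.coord i (T k) := fun i => by
      rw [← sub_add_cancel x (T k), ← vadd_eq_add, AffineMap.map_vadd, hx, map_add, map_smul,
        map_smul, smul_eq_mul, smul_eq_mul, vadd_eq_add]
    have h₁ : T.coord (k + 1) x = t 0 := by
      rw [hcoord, linear_coord_sub, linear_coord_sub, T.coord_apply]
      fin_cases k <;> simp
    have h₂ : T.coord (k + 2) x = t 1 := by
      rw [hcoord, linear_coord_sub, linear_coord_sub, T.coord_apply]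
      fin_cases k <;> simp
    rw [h₁, h₂]
    exact ⟨⟨ht.1 0, ht.2 0⟩, ht.1 1, ht.2 1⟩
  · rintro ⟨h₁, h₂⟩
    refine ⟨![T.coord (k + 1) x, T.coord (k + 2) x], ?_, sub_vertex_eq_coord_smul_add T k x⟩
    constructor <;> intro i <;> fin_cases i
    exacts [h₁.1, h₂.1, h₁.2, h₂.2]

theorem convexHull_triangle_eq :
    convexHull ℝ (Set.range T) =
      parallelogram T k ∩ {x | 0 ≤ T.coord k x} := by
  ext x
  have hsum := coord_add_coord_add_coord T k x
  have hall : (∀ i, 0 ≤ T.coord i x) ↔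
      0 ≤ T.coord k x ∧ 0 ≤ T.coord (k + 1) x ∧ 0 ≤ T.coord (k + 2) x := by
    rw [Fin.forall_fin_succ]
    fin_cases k <;> simp [Fin.forall_fin_two] <;> tauto
  simp only [T.convexHull_eq_nonneg_coord, Set.mem_inter_iff, parallelogram, Set.mem_ofPred_eq,
    Set.mem_Icc, hall]
  constructor
  · rintro ⟨h₀, h₁, h₂⟩
    exact ⟨⟨⟨h₁, by linarith⟩, h₂, by linarith⟩, h₀⟩
  · rintro ⟨⟨⟨h₁, -⟩, h₂, -⟩, h₀⟩
    exact ⟨h₀, h₁, h₂⟩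

theorem coord_vertex_add_vertex_sub (i : Fin 3) (x : V) :
    T.coord i (T (k + 1) + T (k + 2) - x) =
      (if i = k then 0 else 1) - T.coord i x := by
  have hvadd : T (k + 1) + T (k + 2) - x = (T (k + 1) -ᵥ x) +ᵥ T (k + 2) := by
    rw [vsub_eq_sub, vadd_eq_add, sub_add_eq_add_sub]
  rw [hvadd, AffineMap.map_vadd, AffineMap.linearMap_vsub, vsub_eq_sub, vadd_eq_add,
    T.coord_apply, T.coord_apply, sub_add_eq_add_sub]
  congr 1
  fin_cases k <;> fin_cases i <;> simp

theorem preimage_vertex_add_vertex_sub_parallelogram :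
    (fun x => T (k + 1) + T (k + 2) - x) ⁻¹' parallelogram T k = parallelogram T k := by
  have hk : k + 1 ≠ k ∧ k + 2 ≠ k := by fin_cases k <;> decide
  ext x
  simp only [parallelogram, Set.mem_preimage, Set.mem_ofPred_eq, coord_vertex_add_vertex_sub, hk.1,
    hk.2, if_false, Set.mem_Icc, sub_nonneg, sub_le_self_iff, and_comm]

end Coordinates

variable {E : Type*} [NormedAddCommGroup E] [InnerProductSpace ℝ E]

theorem inner_affineGradient_coord_mul_gram [FiniteDimensional ℝ E]
    (T : AffineBasis (Fin 3) ℝ E) (k : Fin 3) :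
    inner ℝ (affineGradient (T.coord (k + 1))) (affineGradient (T.coord (k + 2))) *
        (‖T (k + 1) - T k‖ ^ 2 * ‖T (k + 2) - T k‖ ^ 2 -
          inner ℝ (T (k + 1) - T k) (T (k + 2) - T k) ^ 2) =
      -inner ℝ (T (k + 1) - T k) (T (k + 2) - T k) := by
  have hk : k + 1 ≠ k ∧ k + 1 ≠ k + 2 := by fin_cases k <;> decide
  have ha := inner_affineGradient (T.coord (k + 1)) (T (k + 1) - T k)
  have hb := inner_affineGradient (T.coord (k + 1)) (T (k + 2) - T k)
  rw [linear_coord_sub, if_neg hk.1] at ha hb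
  rw [if_pos rfl, sub_zero] at ha
  rw [if_neg hk.2, sub_zero] at hb
  have hg := eq_linear_coord_smul_add T k (affineGradient (T.coord (k + 1)))
  rw [← inner_affineGradient, ← inner_affineGradient,
    real_inner_comm (affineGradient (T.coord (k + 1))) (affineGradient (T.coord (k + 2)))] at hg
  set g := affineGradient (T.coord (k + 1))
  set s := inner ℝ g (affineGradient (T.coord (k + 2)))
  set a := T (k + 1) - T k
  set b := T (k + 2) - T k
  have ha' : inner ℝ g g * ‖a‖ ^ 2 + s * inner ℝ a b = 1 := by
    rw [← ha]
    conv_rhs => rw [hg]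
    rw [inner_add_left, real_inner_smul_left, real_inner_smul_left, real_inner_self_eq_norm_sq a,
      real_inner_comm a b]
  have hb' : inner ℝ g g * inner ℝ a b + s * ‖b‖ ^ 2 = 0 := by
    rw [← hb]
    conv_rhs => rw [hg]
    rw [inner_add_left, real_inner_smul_left, real_inner_smul_left, real_inner_self_eq_norm_sq b]
  linear_combination ‖a‖ ^ 2 * hb' - inner ℝ a b * ha'

section Area

variable [FiniteDimensional ℝ E] [MeasurableSpace E] [BorelSpace E]

theorem measureReal_parallelepiped_eq_two_mul (μ : Measure E) [μ.IsAddHaarMeasure]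
    (T : AffineBasis (Fin 3) ℝ E) (k : Fin 3) :
    μ.real (parallelepiped ![T (k + 1) - T k, T (k + 2) - T k]) =
      2 * μ.real (convexHull ℝ (Set.range T)) := by
  set P := parallelepiped ![T (k + 1) - T k, T (k + 2) - T k] with hP
  have hPcompact : IsCompact P := isCompact_Icc.image (by fun_prop)
  have hparallelogram : μ (parallelogram T k) = μ P := by
    rw [← preimage_sub_vertex_parallelepiped, ← hP]
    exact (measurePreserving_sub_right μ (T k)).measure_preimage
      hPcompact.measurableSet.nullMeasurableSet
  have hcoord : T.coord k ≠ 0 := fun h => by simpa [h] using T.coord_apply_eq k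
  have hhalf := setIntegral_eq_two_mul_of_symm
    (μ.measurePreserving_sub_left (T (k + 1) + T (k + 2)))
    (MeasurableEquiv.subLeft _).measurableEmbedding
    (preimage_vertex_add_vertex_sub_parallelogram T k) (g := fun _ => 1)
    (fun x => by rw [coord_vertex_add_vertex_sub, if_pos rfl, zero_sub]) (fun _ => rfl)
    (T.coord k).continuous_of_finiteDimensional.measurable (ae_affineMap_ne_zero μ hcoord)
    (integrableOn_const (hparallelogram.trans_lt hPcompact.measure_lt_top).ne)
  rw [← convexHull_triangle_eq T k, setIntegral_const, setIntegral_const, smul_eq_mul, smul_eq_mul,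
    mul_one, mul_one] at hhalf
  rw [← hhalf, Measure.real, Measure.real, hparallelogram]

variable [Fact (Module.finrank ℝ E = 2)]

theorem volume_real_parallelepiped_pair (a b : E) : volume.real (parallelepiped ![a, b]) =
    Real.sin (InnerProductGeometry.angle a b) * (‖a‖ * ‖b‖) := by
  let o : Orientation ℝ E (Fin 2) :=
    ((stdOrthonormalBasis ℝ E).reindex (finCongr Fact.out)).toBasis.orientation
  rw [← o.measure_eq_volume, Measure.real, AlternatingMap.measure_parallelepiped,
    ENNReal.toReal_ofReal (abs_nonneg _), ← o.areaForm_to_volumeForm,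
    InnerProductGeometry.sin_angle_mul_norm_mul_norm, ← Real.sqrt_sq_eq_abs]
  congr 1
  rw [real_inner_self_eq_norm_sq, real_inner_self_eq_norm_sq, ← o.inner_sq_add_areaForm_sq a b]
  ring

theorem two_mul_area_mul_inner_affineGradient_coord (T : AffineBasis (Fin 3) ℝ E) (k : Fin 3) :
    2 * volume.real (convexHull ℝ (Set.range T)) *
        inner ℝ (affineGradient (T.coord (k + 1))) (affineGradient (T.coord (k + 2))) =
      -Real.cot (EuclideanGeometry.angle (T (k + 1)) (T k) (T (k + 2))) := by
  have hgram := inner_affineGradient_coord_mul_gram T k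
  have harea : 0 < 2 * volume.real (convexHull ℝ (Set.range T)) :=
    mul_pos two_pos (measureReal_simplex_pos volume T)
  rw [← measureReal_parallelepiped_eq_two_mul volume T k, volume_real_parallelepiped_pair]
    at harea ⊢
  rw [EuclideanGeometry.angle, vsub_eq_sub, vsub_eq_sub, Real.cot_eq_cos_div_sin]
  set a := T (k + 1) - T k
  set b := T (k + 2) - T k
  rw [← InnerProductGeometry.cos_angle_mul_norm_mul_norm a b] at hgram
  set θ := InnerProductGeometry.angle a b
  have hsin : Real.sin θ ≠ 0 := left_ne_zero_of_mul harea.ne'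
  have hlen : ‖a‖ * ‖b‖ ≠ 0 := right_ne_zero_of_mul harea.ne'
  rw [← neg_div, eq_div_iff hsin]
  refine mul_left_cancel₀ hlen ?_
  linear_combination hgram + (‖a‖ * ‖b‖) ^ 2 *
    inner ℝ (affineGradient (T.coord (k + 1))) (affineGradient (T.coord (k + 2))) *
      Real.sin_sq_add_cos_sq θ

theorem inner_affineGradient_coord_le_of_cot (T : AffineBasis (Fin 3) ℝ E) {β : ℝ}
    (hβ : ∀ k, β * volume.real (convexHull ℝ (Set.range T)) ≤
      6 * Real.cot (EuclideanGeometry.angle (T (k + 1)) (T k) (T (k + 2))))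
    {k l : Fin 3} (hkl : k ≠ l) :
    inner ℝ (affineGradient (T.coord k)) (affineGradient (T.coord l)) ≤ -(β / 12) := by
  have hopposite : ∀ m, inner ℝ (affineGradient (T.coord (m + 1)))
      (affineGradient (T.coord (m + 2))) ≤ -(β / 12) := fun m => by
    refine le_of_mul_le_mul_left ?_ (mul_pos two_pos (measureReal_simplex_pos volume T))
    rw [two_mul_area_mul_inner_affineGradient_coord]
    linarith [hβ m]
  obtain ⟨m, ⟨rfl, rfl⟩ | ⟨rfl, rfl⟩⟩ :
      ∃ m, k = m + 1 ∧ l = m + 2 ∨ k = m + 2 ∧ l = m + 1 := by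
    decide +revert
  · exact hopposite m
  · rw [real_inner_comm]
    exact hopposite m

end Area

end Triangle

open Classical in
theorem theorem5p2 :
    -- one dimension
    (∀ (n : ℕ) (a : Fin (n + 1) → ℝ) (ha : StrictMono a) (b : ℝ → ℝ → ℝ) (Bη : ℝ)
      (u₁ u₂ : ℝ → ℝ),
      LowerOrderTerm (Set.Ioo (a 0) (a (Fin.last n))) b Bη →
      (intervalMesh a ha).IsSubsolution b u₁ →
      (intervalMesh a ha).IsSupersolution b u₂ →
      (∀ k : Fin n, Bη * (a k.succ - a k.castSucc) ^ 2 ≤ 6) →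
      IsStieltjes ((intervalMesh a ha).systemMatrix b u₁ u₂) ∧
      (∀ i j, 0 ≤ ((intervalMesh a ha).systemMatrix b u₁ u₂)⁻¹ i j) ∧
      ∀ x ∈ Set.Ioo (a 0) (a (Fin.last n)), u₁ x ≤ u₂ x) ∧
    -- two dimensions
    (∀ (ι : Type) [Fintype ι] (Ω : Set (EuclideanSpace ℝ (Fin 2))) (M : Mesh ι 2 Ω)
      (b : EuclideanSpace ℝ (Fin 2) → ℝ → ℝ) (Bη : ℝ) (u₁ u₂ : EuclideanSpace ℝ (Fin 2) → ℝ),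
      MeshRegular M →
      LowerOrderTerm Ω b Bη →
      M.IsSubsolution b u₁ →
      M.IsSupersolution b u₂ →
      (∀ T k, Bη * volume.real (M.elem T) ≤ 6 * Real.cot (triangleAngle (M.cell T) k)) →
      IsStieltjes (M.systemMatrix b u₁ u₂) ∧
      (∀ i j, 0 ≤ (M.systemMatrix b u₁ u₂)⁻¹ i j) ∧
      ∀ x ∈ Ω, u₁ x ≤ u₂ x) := by
  refine ⟨fun n a ha b Bη u₁ u₂ hb h₁ h₂ hlen => theorem5p2_general _ hb h₁ h₂ fun T k l hkl => ?_,
    fun ι _ Ω M b Bη u₁ u₂ _ hb h₁ h₂ harea => theorem5p2_general M hb h₁ h₂ fun T k l hkl => ?_⟩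
  · exact (inner_affineGradient_coord_le_of_length (intervalCell a ha T) (hlen T) hkl).trans_eq
      (by norm_num)
  · have : Fact (Module.finrank ℝ (EuclideanSpace ℝ (Fin 2)) = 2) := ⟨finrank_euclideanSpace_fin⟩
    exact (inner_affineGradient_coord_le_of_cot (M.cell T) (harea T) hkl).trans_eq (by norm_num)
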